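/- Let $d\ge 0$ and let $\mathbb P^d=\mathbb P(\mathbb R^{d+1})$. A nonempty open set $\Omega\subset\mathbb P^d$ is \emph{properly convex} if it is contained, convex and bounded in some affine chart. Let $X$ be the set of properly convex open sets with the Hausdorff topology (of closures), and $X^\bullet=\{(\Omega,x): \Omega\in X,\ x\in\Omega\}$. A \emph{projective volume} $\mu$ assigns to each $\Omega\in X$ a measure $\mu_\Omega$ on $\Omega$, absolutely continuous with respect to Lebesgue measure. It is \emph{natural} if it is invariant under $\mathrm{PGL}_{d+1}(\mathbb R)$, that is $\mu_{g\Omega}=g_*\mu_\Omega$, and continuous, in the sense that in every affine chart the density of $\mu_\Omega$ with respect to Lebesgue measure at $x$ is a strictly positive (finite) continuous function of $(\Omega,x)\in X^\bullet$. In a bounded affine chart with a Euclidean norm $|\cdot|$, the Hilbert distance of $\Omega$ is $d_\Omega(x,y)=\frac12\ln\frac{|py|\,|qx|}{|px|\,|qy|}$ for $x\ne y$, where $p,q\in\partial\Omega$ lie on the line $(xy)$ with $p,x,y,q$ in this order, and $d_\Omega(x,x)=0$; its Finsler norm is $F_\Omega(x,v)=\frac{|v|}{2}\left(\frac1{|xp^-|}+\frac1{|xp^+|}\right)$,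 where $p^\pm\in\partial\Omega$ are the points on the half-lines from $x$ in the directions $\pm v$. Let $\mu^{\mathrm{Hil}}_\Omega$ be its Busemann volume: the measure on $\Omega$ with density $\omega_d/\mathrm{Leb}(\{v: F_\Omega(x,v)<1\})$ with respect to Lebesgue measure, where $\omega_d$ is the volume of the Euclidean unit ball. (None of these depends on the chart or on the norm.) Let $\mathrm{Aut}(\Omega)$ be the group of elements of $\mathrm{SL}_{d+1}(\mathbb R)$ preserving a connected component of the preimage of $\Omega$ in $\mathbb R^{d+1}\smallsetminus\{0\}$. The set $\Omega$ is \emph{$\mu$-quasi-divisible} if there is a discrete subgroup $\Gamma$ of $\mathrm{Aut}(\Omega)$ such that $\mu_\Omega$ gives finite volume to $\Omega/\Gamma$ (i.e. to a fundamental domain). The \emph{$\mu$-sup-volume entropy} (resp. \emph{$\mu$-inf-volume entropy}) of $\Omega$ at $x\in\Omega$ is the upper (resp. lower) limit of $\frac1R\log\mu_\Omega(B(x,R))$ as $R\to\infty$, where $B(x,R)$ is the ball of $(\Omega,d_\Omega)$. \textbf{Proposition.} (1) For every natural projective volume $\mu$ on $\mathbb P^d$ there are constants $0<a_d<b_d$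 such that $a_d\,\mu_\Omega\le\mu^{\mathrm{Hil}}_\Omega\le b_d\,\mu_\Omega$ for every properly convex open set $\Omega\subset\mathbb P^d$. (2) If $\mu$ and $\mu'$ are natural projective volumes on $\mathbb P^d$ and $\Omega$ is a properly convex open set, then $\Omega$ is $\mu$-quasi-divisible if and only if it is $\mu'$-quasi-divisible; and for all $x,x'\in\Omega$ the $\mu$-sup-volume (resp. inf-volume) entropy of $\Omega$ at $x$ equals the $\mu'$-sup-volume (resp. inf-volume) entropy of $\Omega$ at $x'$. In particular the entropies depend neither on the base point nor on the natural volume. -/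

import Mathlib

open Set Filter Topology MeasureTheory
open scoped NNReal ENNReal Pointwise

namespace HilbertGeometry

/-! ### Real projective space and its affine charts -/

/-- The `d`-dimensional real projective space: lines of `ℝ^(d+1)`. -/
abbrev RP (d : ℕ) : Type := Projectivization ℝ (Fin (d + 1) → ℝ)

/-- The group `PGL_{d+1}(ℝ)`, which acts on `RP d`. -/
abbrev PGLGroup (d : ℕ) : Type := Matrix.ProjGenLinGroup (Fin (d + 1)) ℝ

/-- The Euclidean space `ℝ^d`. -/
abbrev Euc (d : ℕ) : Type := EuclideanSpace ℝ (Fin d)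

/-- The quotient topology of `ℝ^(d+1) ∖ {0} → RP d`. -/
instance (d : ℕ) : TopologicalSpace (RP d) :=
  inferInstanceAs (TopologicalSpace (Quotient (projectivizationSetoid ℝ (Fin (d + 1) → ℝ))))

instance (d : ℕ) : MeasurableSpace (RP d) := borel (RP d)

instance (d : ℕ) : BorelSpace (RP d) := ⟨rfl⟩

/-- The standard affine chart `x ↦ [1 : x]`, as a parametrisation by `ℝ^d`. -/
noncomputable def stdChart (d : ℕ) (x : Euc d) : RP d :=
  Projectivization.mk ℝ (Fin.cons (1 : ℝ) (fun i => x i) : Fin (d + 1) → ℝ)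
    (fun h => one_ne_zero (congrFun h 0))

/-- The parametrised affine chart `x ↦ g [1 : x]`. Its range is the complement of a projective
hyperplane; letting `g` vary one gets every affine chart of `RP d`, with every choice of a
Euclidean norm on it (transported from the norm of `ℝ^d`). -/
noncomputable def affineChart {d : ℕ} (g : PGLGroup d) (x : Euc d) : RP d :=
  g • stdChart d x

/-! ### Properly convex open sets -/

/-- `Ω` is a (nonempty) properly convex open set: it is contained in an affine chart, and it is
convex and bounded there. -/
def IsProperlyConvexOpen {d : ℕ} (Ω : Set (RP d)) : Prop :=
  IsOpen Ω ∧ Ω.Nonempty ∧ ∃ g : PGLGroup d, Ω ⊆ range (affineChart g) ∧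
    Convex ℝ (affineChart g ⁻¹' Ω) ∧ Bornology.IsBounded (affineChart g ⁻¹' Ω)

/-- The space `X` of properly convex open subsets of `RP d`. -/
def ProperConvex (d : ℕ) : Type := {Ω : Set (RP d) // IsProperlyConvexOpen Ω}

/-- The Hausdorff topology on `X`: two sets are close when their closures are close for the
Hausdorff distance of compact subsets of `RP d`. On compact subsets of a metrizable space the
topology of the Hausdorff distance is the Vietoris topology (for every choice of the metric). -/
instance (d : ℕ) : TopologicalSpace (ProperConvex d) :=
  TopologicalSpace.induced (fun Ω => closure Ω.1) (TopologicalSpace.vietoris (RP d))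

/-- An affine chart in which `Ω` is contained, convex and bounded. -/
noncomputable def ProperConvex.chart {d : ℕ} (Ω : ProperConvex d) : PGLGroup d :=
  Ω.2.2.2.choose

/-- `Ω` seen in the affine chart `Ω.chart`: a bounded convex open subset of `ℝ^d`. -/
noncomputable def ProperConvex.affine {d : ℕ} (Ω : ProperConvex d) : Set (Euc d) :=
  affineChart Ω.chart ⁻¹' Ω.1

/-- The affine coordinates, in the chart `Ω.chart`, of a point of `Ω`. -/
noncomputable def ProperConvex.coord {d : ℕ} (Ω : ProperConvex d) (p : RP d) : Euc d :=
  Function.invFun (affineChart Ω.chart) p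

/-! ### Hilbert distance, Finsler norm, Busemann volume -/

/-- The point where the half-line from `x` with direction `v ≠ 0` leaves the bounded convex open
set `U ∋ x`, i.e. its intersection with the boundary of `U`. -/
noncomputable def exitPoint {d : ℕ} (U : Set (Euc d)) (x v : Euc d) : Euc d :=
  x + sSup {t : ℝ | 0 ≤ t ∧ x + t • v ∈ U} • v

open Classical in
/-- The Hilbert distance of a bounded convex open set `U ⊆ ℝ^d`: half the logarithm of the
cross-ratio `[p : x : y : q]`, where `p, x, y, q` are aligned in this order and `p, q ∈ ∂U`. -/
noncomputable def affineHilbertDist {d : ℕ} (U : Set (Euc d)) (x y : Euc d) : ℝ :=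
  if x = y then 0 else
    1 / 2 * Real.log
      ((dist (exitPoint U y (x - y)) y * dist (exitPoint U x (y - x)) x) /
        (dist (exitPoint U y (x - y)) x * dist (exitPoint U x (y - x)) y))

/-- The Hilbert distance of `Ω` (computed in the bounded chart `Ω.chart`). -/
noncomputable def hilbertDist {d : ℕ} (Ω : ProperConvex d) (p q : RP d) : ℝ :=
  affineHilbertDist Ω.affine (Ω.coord p) (Ω.coord q)

/-- The ball of centre `p` and radius `R` of `Ω` for the Hilbert distance. -/
def hilbertBall {d : ℕ} (Ω : ProperConvex d) (p : RP d) (R : ℝ) : Set (RP d) :=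
  {q | q ∈ Ω.1 ∧ hilbertDist Ω p q < R}

/-- The Finsler norm `F(x, v) = |v| / 2 * (1 / |x p⁻| + 1 / |x p⁺|)` of the Hilbert distance of a
bounded convex open set `U ⊆ ℝ^d`, where `p⁻, p⁺` are the points of `∂U` on the half-lines from
`x` with directions `-v` and `v` (and `F(x, 0) = 0`). -/
noncomputable def affineFinsler {d : ℕ} (U : Set (Euc d)) (x v : Euc d) : ℝ :=
  ‖v‖ / 2 * (1 / dist x (exitPoint U x (-v)) + 1 / dist x (exitPoint U x v))

/-- The Busemann volume of a bounded convex open set `U ⊆ ℝ^d`: the measure on `U` whose density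
with respect to Lebesgue measure at `x` is the volume of the Euclidean unit ball divided by the
volume of the unit ball of `F(x, ·)`. -/
noncomputable def affineBusemann {d : ℕ} (U : Set (Euc d)) : Measure (Euc d) :=
  (volume.restrict U).withDensity fun x =>
    volume (Metric.ball (0 : Euc d) 1) / volume {v : Euc d | affineFinsler U x v < 1}

/-- The Busemann volume `μ^Hil_Ω` of `Ω`, as a measure on `RP d` carried by `Ω`. -/
noncomputable def busemannVolume {d : ℕ} (Ω : ProperConvex d) : Measure (RP d) :=
  (affineBusemann Ω.affine).map (affineChart Ω.chart)

/-! ### Projective volumes -/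

/-- A projective volume: to every properly convex open set `Ω` is attached a measure on `Ω` (that
is, a measure on `RP d` carried by `Ω`) absolutely continuous with respect to Lebesgue measure. -/
structure IsProjectiveVolume {d : ℕ} (μ : ProperConvex d → Measure (RP d)) : Prop where
  carried : ∀ Ω : ProperConvex d, μ Ω Ω.1ᶜ = 0
  absolutelyContinuous : ∀ (Ω : ProperConvex d) (g : PGLGroup d), Ω.1 ⊆ range (affineChart g) →
    μ Ω ≪ (volume : Measure (Euc d)).map (affineChart g)

/-- A natural projective volume: it is invariant under `PGL_{d+1}(ℝ)`, and its density with
respect to the Lebesgue measure of any affine chart is a positive function which is continuous in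
the pair `(Ω, x)`, `x ∈ Ω` (for the Hausdorff topology in `Ω`). -/
structure IsNaturalVolume {d : ℕ} (μ : ProperConvex d → Measure (RP d)) : Prop
    extends IsProjectiveVolume μ where
  invariant : ∀ (g : PGLGroup d) (Ω Ω' : ProperConvex d), Ω'.1 = g • Ω.1 →
    μ Ω' = (μ Ω).map (fun p => g • p)
  continuous : ∀ g : PGLGroup d, ∃ f : ProperConvex d → Euc d → ℝ,
    ContinuousOn (fun z : ProperConvex d × Euc d => f z.1 z.2) {z | affineChart g z.2 ∈ z.1.1} ∧
    (∀ (Ω : ProperConvex d) (x : Euc d), affineChart g x ∈ Ω.1 → 0 < f Ω x) ∧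
    ∀ Ω : ProperConvex d, (μ Ω).restrict (range (affineChart g)) =
      ((volume.restrict (affineChart g ⁻¹' Ω.1)).withDensity
        fun x => ENNReal.ofReal (f Ω x)).map (affineChart g)

/-! ### Quasi-divisibility and volume entropy -/

/-- The preimage of `Ω` in `ℝ^(d+1) ∖ {0}`. Its connected components are the two opposite cones
above `Ω`. -/
def conePreimage {d : ℕ} (Ω : ProperConvex d) : Set (Fin (d + 1) → ℝ) :=
  {v | ∃ hv : v ≠ 0, Projectivization.mk ℝ v hv ∈ Ω.1}

/-- `Aut(Ω)`: the elements of `SL_{d+1}(ℝ)` that preserve the cone above `Ω` (it is the same to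
preserve one of the two cones or both). -/
def autGroup {d : ℕ} (Ω : ProperConvex d) :
    Subgroup (Matrix.SpecialLinearGroup (Fin (d + 1)) ℝ) :=
  ⨅ v ∈ conePreimage Ω, MulAction.stabilizer (Matrix.SpecialLinearGroup (Fin (d + 1)) ℝ)
    (connectedComponentIn (conePreimage Ω) v)

/-- `Ω` is `μ`-quasi-divisible: there is a discrete subgroup `Γ` of `Aut(Ω)` such that `Ω / Γ` has
finite `μ`-volume, the volume of the quotient being the volume of a fundamental domain. -/
def IsQuasiDivisible {d : ℕ} (μ : ProperConvex d → Measure (RP d)) (Ω : ProperConvex d) : Prop :=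
  ∃ Γ : Subgroup (Matrix.SpecialLinearGroup (Fin (d + 1)) ℝ), Γ ≤ autGroup Ω ∧
    DiscreteTopology Γ ∧ ∃ D : Set (RP d), IsFundamentalDomain Γ D (μ Ω) ∧ μ Ω D < ∞

/-- The `μ`-sup-volume entropy of `Ω`, computed from the base point `x`. -/
noncomputable def supVolumeEntropy {d : ℕ} (μ : ProperConvex d → Measure (RP d))
    (Ω : ProperConvex d) (x : RP d) : EReal :=
  limsup (fun R : ℝ => ENNReal.log (μ Ω (hilbertBall Ω x R)) / (R : EReal)) atTop

/-- The `μ`-inf-volume entropy of `Ω`, computed from the base point `x`. -/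
noncomputable def infVolumeEntropy {d : ℕ} (μ : ProperConvex d → Measure (RP d))
    (Ω : ProperConvex d) (x : RP d) : EReal :=
  liminf (fun R : ℝ => ENNReal.log (μ Ω (hilbertBall Ω x R)) / (R : EReal)) atTop

end HilbertGeometry

open HilbertGeometry

namespace HilbertGeometry

variable {d : ℕ}

/-! ### Topology of the projective space -/

/-! The argument is Benzécri's: up to projective transformations, pointed properly convex sets `(Ω,
x)` form a compact family. Given `(U, x)` in a bounded chart, consider the linear forms nonnegative
on the cone above `U` and equal to `1` at `(1, x)`. They form a compact set, and a basis of them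
with maximal determinant (an Auerbach basis) provides coordinates in which `x` becomes `0` and `U`
lies between two balls whose radii depend only on `d` (`exists_normalizes`).

Let `T` be the derivative at `x` of this normalisation. A half-line from `x` goes to a half-line
from `0`, so the two radii bound the Finsler norm at `x` above and below by multiples of `‖T v‖`;
the Busemann density is therefore comparable to `|det T|` (`Normalizes.busemann_density_bounds`). By
invariance and change of variables, the density of a natural volume at `x` is exactly `|det T|`
times the density of the normalised set at `0` (`IsNaturalVolume.density_eq`). This last factor is a
positive continuous function on a compact space of convex bodies, hence bounded away from `0` and
`∞` (`exists_bounds_of_continuousOn`). This yields the uniform comparison with the Busemann volume.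

Any two natural volumes are then comparable, through the Busemann one. The same group and
fundamental domain serve for both. In the entropies, a multiplicative constant adds a bounded term
to the logarithm, and a change of base point shifts the radius by a constant, by the triangle
inequality; neither matters after division by `R`. The triangle inequality comes from the order
defined by the cone above `U` (`ConeLE`). -/

theorem isQuotientMap_mk (d : ℕ) :
    IsQuotientMap fun v : {v : Fin (d + 1) → ℝ // v ≠ 0} =>
      (Projectivization.mk ℝ v.1 v.2 : RP d) :=
  isQuotientMap_quot_mk

/-- The vector `(1, u)` above the point `[1 : u]`. -/
noncomputable def hom (u : Euc d) : Fin (d + 1) → ℝ := Fin.cons 1 fun i => u i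

@[simp] theorem hom_zero (u : Euc d) : hom u 0 = 1 := rfl

@[simp] theorem hom_succ (u : Euc d) (i : Fin d) : hom u i.succ = u i := rfl

theorem hom_ne_zero (u : Euc d) : hom u ≠ 0 := fun h => one_ne_zero (congrFun h 0)

theorem stdChart_eq (u : Euc d) : stdChart d u = Projectivization.mk ℝ (hom u) (hom_ne_zero u) := rfl

theorem continuous_hom : Continuous (hom : Euc d → Fin (d + 1) → ℝ) := by
  refine continuous_pi fun i => ?_
  refine Fin.cases ?_ (fun i => ?_) i
  · exact continuous_const
  · simp only [hom_succ]; fun_prop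

theorem mk_eq_stdChart_iff (v : Fin (d + 1) → ℝ) (hv : v ≠ 0) (u : Euc d) :
    Projectivization.mk ℝ v hv = stdChart d u ↔ v = v 0 • hom u := by
  rw [stdChart_eq, Projectivization.mk_eq_mk_iff']
  constructor
  · rintro ⟨a, rfl⟩
    simp
  · intro h
    exact ⟨v 0, h.symm⟩

/-- The affine coordinates `v' / v₀` of the projective point `[v₀ : v']`. -/
noncomputable def dehom (v : Fin (d + 1) → ℝ) : Euc d := WithLp.toLp 2 fun i => v i.succ / v 0

@[simp] theorem dehom_apply (v : Fin (d + 1) → ℝ) (i : Fin d) : dehom v i = v i.succ / v 0 := rfl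

theorem smul_hom_dehom {v : Fin (d + 1) → ℝ} (h : v 0 ≠ 0) : v 0 • hom (dehom v) = v := by
  ext i
  refine Fin.cases ?_ (fun i => ?_) i
  · simp
  · simp [mul_div_cancel₀ _ h]

theorem dehom_smul_hom {c : ℝ} (hc : c ≠ 0) (u : Euc d) : dehom (c • hom u) = u := by
  ext i
  simp [hc]

theorem hom_injective : Function.Injective (hom : Euc d → Fin (d + 1) → ℝ) := by
  intro u w h
  have := dehom_smul_hom one_ne_zero u
  rw [h, dehom_smul_hom one_ne_zero w] at this
  exact this.symm

theorem mk_eq_stdChart_iff' (v : Fin (d + 1) → ℝ) (hv : v ≠ 0) (u : Euc d) :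
    Projectivization.mk ℝ v hv = stdChart d u ↔ v 0 ≠ 0 ∧ dehom v = u := by
  rw [mk_eq_stdChart_iff]
  constructor
  · intro h
    have h0 : v 0 ≠ 0 := fun h0 => hv (by rw [h, h0, zero_smul])
    exact ⟨h0, by rw [h, dehom_smul_hom h0]⟩
  · rintro ⟨h0, rfl⟩
    exact (smul_hom_dehom h0).symm

theorem stdChart_injective : Function.Injective (stdChart d) := by
  intro u w h
  rw [stdChart_eq, mk_eq_stdChart_iff'] at h
  simpa using (dehom_smul_hom one_ne_zero u).symm.trans (by simpa using h.2)

theorem continuous_stdChart : Continuous (stdChart d) :=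
  (isQuotientMap_mk d).continuous.comp
    (continuous_hom.subtype_mk (p := fun v : Fin (d + 1) → ℝ => v ≠ 0) hom_ne_zero)

theorem continuousOn_dehom :
    ContinuousOn (dehom : (Fin (d + 1) → ℝ) → Euc d) {v | v 0 ≠ 0} := by
  refine (PiLp.continuous_toLp 2 _).comp_continuousOn (continuousOn_pi.2 fun i => ?_)
  exact ContinuousOn.div (by fun_prop) (by fun_prop) fun v hv => hv

theorem isOpen_stdChart_image {V : Set (Euc d)} (hV : IsOpen V) : IsOpen (stdChart d '' V) := by
  rw [← (isQuotientMap_mk d).isOpen_preimage]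
  have h1 : IsOpen ({v : Fin (d + 1) → ℝ | v 0 ≠ 0} ∩ dehom ⁻¹' V) :=
    continuousOn_dehom.isOpen_inter_preimage
      (isOpen_ne_fun (continuous_apply 0) continuous_const) hV
  convert h1.preimage (continuous_subtype_val (p := fun v : Fin (d + 1) → ℝ => v ≠ 0)) using 1
  ext ⟨v, hv⟩
  simp only [mem_preimage, mem_image, mem_inter_iff, mem_ofPred_eq]
  constructor
  · rintro ⟨u, hu, h⟩
    obtain ⟨h0, rfl⟩ := (mk_eq_stdChart_iff' v hv u).1 h.symm
    exact ⟨h0, hu⟩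
  · rintro ⟨h0, hu⟩
    exact ⟨_, hu, ((mk_eq_stdChart_iff' v hv _).2 ⟨h0, rfl⟩).symm⟩

theorem continuous_smul_pgl (g : PGLGroup d) : Continuous fun p : RP d => g • p := by
  induction g using Matrix.ProjGenLinGroup.induction_on with
  | mk A =>
    rw [(isQuotientMap_mk d).continuous_iff]
    have h : Continuous fun v : {v : Fin (d + 1) → ℝ // v ≠ 0} =>
        (⟨A • v.1, (smul_ne_zero_iff_ne A).2 v.2⟩ : {v : Fin (d + 1) → ℝ // v ≠ 0}) := by
      refine Continuous.subtype_mk ?_ _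
      change Continuous fun v : {v : Fin (d + 1) → ℝ // v ≠ 0} => A.1.mulVec v.1
      exact continuous_const.matrix_mulVec continuous_subtype_val
    exact (isQuotientMap_mk d).continuous.comp h

theorem isOpen_smul_pgl (g : PGLGroup d) {s : Set (RP d)} (hs : IsOpen s) : IsOpen (g • s) := by
  rw [← Set.preimage_smul_inv]
  exact hs.preimage (continuous_smul_pgl g⁻¹)

theorem continuous_affineChart (g : PGLGroup d) : Continuous (affineChart g) :=
  (continuous_smul_pgl g).comp continuous_stdChart

theorem affineChart_injective (g : PGLGroup d) : Function.Injective (affineChart g) :=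
  (MulAction.injective g).comp stdChart_injective

theorem affineChart_one : affineChart (1 : PGLGroup d) = stdChart d := by
  funext x
  exact one_smul _ _

/-- The line of `v` is determined by the orthogonal projection onto it, whose matrix `v vᵀ / (v ·
v)` depends continuously on `v`: this injects `RP d` continuously into a space of matrices. -/
instance : T2Space (RP d) := by
  let F : {v : Fin (d + 1) → ℝ // v ≠ 0} → (Fin (d + 1) → Fin (d + 1) → ℝ) :=
    fun v i j => v.1 i * v.1 j / (v.1 ⬝ᵥ v.1)
  have hpos : ∀ v : Fin (d + 1) → ℝ, v ≠ 0 → v ⬝ᵥ v ≠ 0 := fun v hv h =>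
    hv (dotProduct_self_eq_zero.1 h)
  have hF : ∀ (a b : {v : Fin (d + 1) → ℝ // v ≠ 0}) (t : ℝ),
      a.1 = t • b.1 → F a = F b := by
    rintro ⟨a, ha⟩ ⟨b, hb⟩ t h
    simp only at h
    have ht : t ≠ 0 := fun h0 => ha (by rw [h, h0, zero_smul])
    funext i j
    have := hpos b hb
    simp only [F, h, Pi.smul_apply, smul_eq_mul, smul_dotProduct, dotProduct_smul]
    field_simp
  have hv (i : Fin (d + 1)) : Continuous fun v : {v : Fin (d + 1) → ℝ // v ≠ 0} => v.1 i :=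
    (continuous_apply i).comp continuous_subtype_val
  have hc : Continuous F := by
    refine continuous_pi fun i => continuous_pi fun j => Continuous.div ?_ ?_ fun v => hpos v.1 v.2
    · exact (hv i).mul (hv j)
    · exact continuous_finsetSum _ fun i _ => (hv i).mul (hv i)
  refine T2Space.of_injective_continuous (f := Projectivization.lift F hF) ?_ ?_
  · intro p q
    induction p using Projectivization.ind with | h v hv =>
    induction q using Projectivization.ind with | h w hw =>
    intro h
    simp only [Projectivization.lift_mk] at h
    obtain ⟨j, hj⟩ := Function.ne_iff.1 hv
    rw [Projectivization.mk_eq_mk_iff']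
    refine ⟨w j / (w ⬝ᵥ w) * (v ⬝ᵥ v) / v j, funext fun i => ?_⟩
    have := congrFun (congrFun h i) j
    have h1 := hpos v hv
    have h2 := hpos w hw
    simp only [F] at this
    simp only [Pi.zero_apply] at hj
    rw [div_eq_div_iff h1 h2] at this
    simp only [Pi.smul_apply, smul_eq_mul]
    field_simp
    linarith
  · rw [(isQuotientMap_mk d).continuous_iff]
    exact hc

/-! ### Normalisation of pointed properly convex sets -/

theorem dotProduct_hom (a : Fin (d + 1) → ℝ) (u : Euc d) :
    a ⬝ᵥ hom u = a 0 + ∑ i : Fin d, a i.succ * u i := by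
  simp [dotProduct, Fin.sum_univ_succ]

/-- The linear forms on `ℝ^(d+1)` that are nonnegative on the cone above `U` and equal to `1` at
`(1, x)`. -/
def dualSlice (U : Set (Euc d)) (x : Euc d) : Set (Fin (d + 1) → ℝ) :=
  {a | (∀ u ∈ U, 0 ≤ a ⬝ᵥ hom u) ∧ a ⬝ᵥ hom x = 1}

/-- If `U` contains the `ε`-ball at `x`, nonnegativity at `x ± (ε / 2) eᵢ` together with the value
`1` at `x` bounds each linear coefficient by `2 / ε`; the normalisation at `x` then bounds the
constant coefficient. -/
theorem isCompact_dualSlice {U : Set (Euc d)} (hU : IsOpen U) {x : Euc d} (hx : x ∈ U) :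
    IsCompact (dualSlice U x) := by
  have hcont (u : Euc d) : Continuous fun a : Fin (d + 1) → ℝ => a ⬝ᵥ hom u := by
    simp only [dotProduct_hom]; fun_prop
  have hclosed : IsClosed (dualSlice U x) := by
    have : dualSlice U x = (⋂ u ∈ U, {a | 0 ≤ a ⬝ᵥ hom u}) ∩ {a | a ⬝ᵥ hom x = 1} := by
      ext a; simp [dualSlice]
    rw [this]
    exact (isClosed_biInter fun u _ => isClosed_le continuous_const (hcont u)).inter
      (isClosed_eq (hcont x) continuous_const)
  obtain ⟨ε, hε, hball⟩ := Metric.isOpen_iff.1 hU x hx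
  have hb (a) (ha : a ∈ dualSlice U x) (i : Fin d) : |a i.succ| ≤ 2 / ε := by
    have key (t : ℝ) (ht : |t| < ε) : 0 ≤ 1 + t * a i.succ := by
      have hmem : x + EuclideanSpace.single i t ∈ U := hball (by simpa using ht)
      have h1 := ha.1 _ hmem
      have h2 := ha.2
      rw [dotProduct_hom] at h1 h2
      simp only [PiLp.add_apply, mul_add, Finset.sum_add_distrib, PiLp.single_apply,
        mul_ite, mul_zero, Finset.sum_ite_eq', Finset.mem_univ, if_true] at h1
      linarith
    have h1 := key (ε / 2) (by rw [abs_of_pos (half_pos hε)]; linarith)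
    have h2 := key (-(ε / 2)) (by rw [abs_neg, abs_of_pos (half_pos hε)]; linarith)
    rw [abs_le, ← neg_div, div_le_iff₀ hε, le_div_iff₀ hε]
    constructor <;> linarith
  refine (isCompact_univ_pi fun _ : Fin (d + 1) =>
    isCompact_Icc (a := -(1 + 2 / ε + ∑ i, 2 / ε * |x i|))
      (b := 1 + 2 / ε + ∑ i, 2 / ε * |x i|)).of_isClosed_subset hclosed ?_
  intro a ha i _
  refine abs_le.1 ?_
  have hs : 0 ≤ ∑ i, 2 / ε * |x i| := Finset.sum_nonneg fun i _ => by positivity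
  have hs' : 0 ≤ 2 / ε := by positivity
  refine Fin.cases ?_ (fun i => ?_) i
  · have h2 := ha.2
    rw [dotProduct_hom] at h2
    have h3 : |∑ i, a i.succ * x i| ≤ ∑ i, 2 / ε * |x i| := by
      refine (Finset.abs_sum_le_sum_abs _ _).trans (Finset.sum_le_sum fun i _ => ?_)
      rw [abs_mul]
      exact mul_le_mul_of_nonneg_right (hb a ha i) (abs_nonneg _)
    have h4 : a 0 = 1 - ∑ i, a i.succ * x i := by linarith
    rw [h4]
    refine (abs_sub _ _).trans ?_
    rw [abs_one]
    linarith
  · have := hb a ha i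
    linarith

/-- A point of `ℝ^(d+1)` on which all the forms of the dual slice are positive lies in the cone. -/
theorem mem_cone_of_dualSlice_pos {U : Set (Euc d)} (hU : IsOpen U) (hc : Convex ℝ U)
    {x : Euc d} (hx : x ∈ U) {y : Fin (d + 1) → ℝ} (hy : ∀ a ∈ dualSlice U x, 0 < a ⬝ᵥ y) :
    0 < y 0 ∧ dehom y ∈ U := by
  have h0 : 0 < y 0 := by
    -- The form `v ↦ v 0` is `1` on all of `hom '' U`, so it belongs to the slice.
    have := hy (Pi.single 0 1) ⟨fun u _ => by simp, by simp⟩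
    simpa using this
  refine ⟨h0, by_contra fun hn => ?_⟩
  obtain ⟨f, hf⟩ := geometric_hahn_banach_open_point hc hU hn
  set u := dehom y
  have hpos : 0 < f u - f x := sub_pos.2 (hf x hx)
  have hrep (w : Euc d) : f w = ∑ i, f (EuclideanSpace.single i 1) * w i := by
    conv_lhs => rw [← (EuclideanSpace.basisFun (Fin d) ℝ).sum_repr w]
    simp [mul_comm]
  -- The affine function `w ↦ (f u - f w) / (f u - f x)`, written as a form: nonnegative on `U`,
  -- equal to `1` at `x`, but zero at `u`, which contradicts `hy`.
  let a : Fin (d + 1) → ℝ :=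
    Fin.cons (f u / (f u - f x)) fun i => -f (EuclideanSpace.single i 1) / (f u - f x)
  have ha (w : Euc d) : a ⬝ᵥ hom w = (f u - f w) / (f u - f x) := by
    rw [dotProduct_hom, hrep w]
    simp only [a, Fin.cons_zero, Fin.cons_succ, sub_div, Finset.sum_div, neg_div, neg_mul,
      Finset.sum_neg_distrib, div_mul_eq_mul_div]
    ring
  have hmem : a ∈ dualSlice U x := by
    refine ⟨fun w hw => ?_, ?_⟩
    · rw [ha]; exact div_nonneg (sub_nonneg.2 (hf w hw).le) hpos.le
    · rw [ha, div_self hpos.ne']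
  have := hy a hmem
  rw [← smul_hom_dehom h0.ne', dotProduct_smul, ha] at this
  simp [u] at this

/-- Boundedness of `U` makes the slice span: if `U` lies in the `M`-ball at `x`, the functions `1`
and `(M + (u - x) i) / M` are nonnegative on `U` and equal to `1` at `x`. -/
theorem exists_det_ne_zero_dualSlice {U : Set (Euc d)} (hb : Bornology.IsBounded U) (x : Euc d) :
    ∃ L : Fin (d + 1) → Fin (d + 1) → ℝ, (∀ i, L i ∈ dualSlice U x) ∧ (Matrix.of L).det ≠ 0 := by
  obtain ⟨M, hM0, hM⟩ := hb.subset_ball_lt 0 x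
  let L : Fin (d + 1) → Fin (d + 1) → ℝ :=
    Fin.cons (Pi.single 0 1) fun i => Fin.cons (1 - x i / M) (Pi.single i (1 / M))
  have hL0 (v : Fin (d + 1) → ℝ) : L 0 ⬝ᵥ v = v 0 := by simp [L]
  have hLs (i : Fin d) (v : Fin (d + 1) → ℝ) :
      L i.succ ⬝ᵥ v = (1 - x i / M) * v 0 + 1 / M * v i.succ := by
    simp [L, dotProduct, Fin.sum_univ_succ, Pi.single_apply]
  refine ⟨L, fun i => ?_, fun hdet => ?_⟩
  · refine Fin.cases ?_ (fun i => ?_) i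
    · exact ⟨fun u _ => by rw [hL0]; simp, by rw [hL0]; simp⟩
    · refine ⟨fun u hu => ?_, ?_⟩
      · rw [hLs, hom_zero, hom_succ]
        have h1 : |(u - x) i| ≤ M := by
          refine (PiLp.norm_apply_le (u - x) i).trans ?_
          rw [← dist_eq_norm]
          exact (hM hu).le
        have h2 : (1 - x i / M) * 1 + 1 / M * u i = (M + (u - x) i) / M := by
          simp only [PiLp.sub_apply]
          field_simp
          ring
        rw [h2]
        exact div_nonneg (by linarith [(abs_le.1 h1).1]) hM0.le
      · rw [hLs, hom_zero, hom_succ]; ring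
  · obtain ⟨v, hv, h⟩ := Matrix.exists_mulVec_eq_zero_iff.2 hdet
    have h0 : v 0 = 0 := by
      rw [← hL0 v]; exact congrFun h 0
    refine hv (funext fun i => ?_)
    refine Fin.cases h0 (fun i => ?_) i
    have h1 : L i.succ ⬝ᵥ v = 0 := congrFun h i.succ
    rw [hLs, h0, mul_zero, zero_add] at h1
    simpa [hM0.ne'] using h1

/-- The dual slice has a basis of elements with respect to which all coordinates of its elements
are at most one in absolute value. -/
theorem exists_auerbach_dualSlice {U : Set (Euc d)} (hU : IsOpen U) (hb : Bornology.IsBounded U)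
    {x : Euc d} (hx : x ∈ U) :
    ∃ L : Matrix (Fin (d + 1)) (Fin (d + 1)) ℝ, (∀ i, L i ∈ dualSlice U x) ∧ L.det ≠ 0 ∧
      ∀ a ∈ dualSlice U x, ∃ c : Fin (d + 1) → ℝ,
        a = ∑ i, c i • L i ∧ (∀ i, |c i| ≤ 1) ∧ ∑ i, c i = 1 := by
  obtain ⟨L₀, hL₀, hdet₀⟩ := exists_det_ne_zero_dualSlice hb x
  have hcomp := isCompact_univ_pi fun _ : Fin (d + 1) => isCompact_dualSlice hU hx
  have hcont : Continuous fun L : Fin (d + 1) → Fin (d + 1) → ℝ => |(Matrix.of L).det| :=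
    (Continuous.matrix_det (A := fun L : Fin (d + 1) → Fin (d + 1) → ℝ => Matrix.of L)
      continuous_id).abs
  -- Auerbach's choice: the tuple in the slice with the largest absolute determinant.
  obtain ⟨L, hL, hmax⟩ := hcomp.exists_isMaxOn ⟨L₀, fun i _ => hL₀ i⟩ hcont.continuousOn
  have hdet : (Matrix.of L).det ≠ 0 := by
    have h1 : |(Matrix.of L₀).det| ≤ |(Matrix.of L).det| := hmax fun i _ => hL₀ i
    exact abs_pos.1 ((abs_pos.2 hdet₀).trans_le h1)
  refine ⟨Matrix.of L, fun i => hL i trivial, hdet, fun a ha => ?_⟩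
  have hunit : IsUnit (Matrix.of L).det := isUnit_iff_ne_zero.2 hdet
  let c := Matrix.vecMul a (Matrix.of L)⁻¹
  have hc : a = ∑ i, c i • Matrix.of L i := by
    have : Matrix.vecMul c (Matrix.of L) = a := by
      simp [c, Matrix.vecMul_vecMul, Matrix.nonsing_inv_mul _ hunit]
    rw [← this, Matrix.vecMul_eq_sum]
  refine ⟨c, hc, fun i => ?_, ?_⟩
  -- Cramer's rule: replacing row `i` by `a` multiplies the determinant by `c i`, so maximality
  -- forces `|c i| ≤ 1`.
  · have h1 : |(Matrix.of (Function.update L i a)).det| ≤ |(Matrix.of L).det| := by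
      refine hmax fun j _ => ?_
      by_cases hj : j = i
      · subst hj; simpa using ha
      · simpa [hj] using hL j trivial
    have h2 : (Matrix.of (Function.update L i a)).det = c i • (Matrix.of L).det := by
      rw [← Matrix.det_updateRow_sum (Matrix.of L) i c, ← hc]
      rfl
    rw [h2, smul_eq_mul, abs_mul] at h1
    exact le_of_mul_le_mul_right (by rwa [one_mul]) (abs_pos.2 hdet)
  -- All the forms take the value `1` at `(1, x)`, so evaluating there gives the sum of the
  -- coefficients.
  · have h1 := ha.2
    rw [hc, sum_dotProduct] at h1
    rw [← h1]
    refine Finset.sum_congr rfl fun i _ => ?_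
    rw [smul_dotProduct, smul_eq_mul]
    have : Matrix.of L i ⬝ᵥ hom x = 1 := (hL i trivial).2
    rw [this, mul_one]

/-- The projective transformation of matrix `A` in the standard affine chart. -/
noncomputable def fracLin (A : Matrix (Fin (d + 1)) (Fin (d + 1)) ℝ) (u : Euc d) : Euc d :=
  dehom (A.mulVec (hom u))

/-- Outer radius of normalised convex sets. -/
noncomputable def outerRadius (d : ℕ) : ℝ := (d + 1) ^ 2

/-- Inner radius of normalised convex sets. -/
noncomputable def innerRadius (d : ℕ) : ℝ := 1 / (2 * (d + 1))

theorem outerRadius_pos (d : ℕ) : 0 < outerRadius d := by unfold outerRadius; positivity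

theorem innerRadius_pos (d : ℕ) : 0 < innerRadius d := by unfold innerRadius; positivity

/-- The projective transformation `A` sends the pointed set `(U, x)` into normalised position. -/
structure Normalizes (A : Matrix (Fin (d + 1)) (Fin (d + 1)) ℝ) (U : Set (Euc d)) (x : Euc d) :
    Prop where
  det_ne_zero : A.det ≠ 0
  map_base : A.mulVec (hom x) = hom 0
  pos : ∀ u ∈ U, 0 < A.mulVec (hom u) 0
  image_subset : fracLin A '' U ⊆ Metric.closedBall 0 (outerRadius d)
  subset_image : Metric.ball 0 (innerRadius d) ⊆ fracLin A '' U

theorem norm_le_outerRadius {z : Euc d} (h : ∀ i, |z i| ≤ d + 1) : ‖z‖ ≤ outerRadius d := by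
  rw [EuclideanSpace.norm_eq]
  refine Real.sqrt_le_iff.2 ⟨(outerRadius_pos d).le, ?_⟩
  calc ∑ i, ‖z i‖ ^ 2 ≤ ∑ _i : Fin d, ((d : ℝ) + 1) ^ 2 :=
        Finset.sum_le_sum fun i _ => pow_le_pow_left₀ (norm_nonneg _) (h i) 2
    _ = d * ((d : ℝ) + 1) ^ 2 := by simp
    _ ≤ ((d : ℝ) + 1) ^ 2 * ((d : ℝ) + 1) ^ 2 := by
        refine mul_le_mul_of_nonneg_right ?_ (by positivity)
        nlinarith [(Nat.cast_nonneg d : (0 : ℝ) ≤ d)]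
    _ = outerRadius d ^ 2 := by unfold outerRadius; ring

/-- Take as homogeneous coordinate the mean `m` of the Auerbach forms, and as affine coordinates `L
i.succ / m - 1`. On `U` the forms are nonnegative with sum `(d + 1) m`, so each quotient lies in
`[0, d + 1]`: this gives the outer ball. For the inner ball, expand an arbitrary form of the slice
in the basis: its coefficients are at most `1` in absolute value, so over `z` it is at least `1 - 2
∑ |z i|`, which is positive when `‖z‖ < 1 / (2 (d + 1))`. -/
theorem exists_normalizes {U : Set (Euc d)} (hU : IsOpen U) (hc : Convex ℝ U)
    (hb : Bornology.IsBounded U) {x : Euc d} (hx : x ∈ U) :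
    ∃ A : Matrix (Fin (d + 1)) (Fin (d + 1)) ℝ, Normalizes A U x := by
  obtain ⟨L, hL, hdet, hcoord⟩ := exists_auerbach_dualSlice hU hb hx
  have hd : (0 : ℝ) < d + 1 := by positivity
  let m : (Fin (d + 1) → ℝ) → ℝ := fun y => (∑ i, L i ⬝ᵥ y) / (d + 1)
  let A : Matrix (Fin (d + 1)) (Fin (d + 1)) ℝ :=
    Matrix.of (Fin.cons ((1 / ((d : ℝ) + 1)) • ∑ i, L i)
      fun i => L i.succ - (1 / ((d : ℝ) + 1)) • ∑ i, L i)
  have hsd (y) : (∑ i, L i) ⬝ᵥ y = ∑ i, L i ⬝ᵥ y := sum_dotProduct _ _ _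
  have hA0 (y) : A.mulVec y 0 = m y := by
    simp only [Matrix.mulVec, A, m, Matrix.of_apply, Fin.cons_zero, smul_dotProduct,
      hsd, smul_eq_mul]
    ring
  have hAs (y) (i : Fin d) : A.mulVec y i.succ = L i.succ ⬝ᵥ y - m y := by
    simp only [Matrix.mulVec, A, m, Matrix.of_apply, Fin.cons_succ, sub_dotProduct,
      smul_dotProduct, hsd, smul_eq_mul]
    ring
  have hLzero (y) (h : ∀ i, L i ⬝ᵥ y = 0) : y = 0 := by
    by_contra hy
    exact hdet (Matrix.exists_mulVec_eq_zero_iff.1 ⟨y, hy, funext h⟩)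
  have hsum (y) : L 0 ⬝ᵥ y + ∑ i : Fin d, L i.succ ⬝ᵥ y = (d + 1) * m y := by
    simp only [m]
    rw [← Fin.sum_univ_succ (fun i => L i ⬝ᵥ y)]
    field_simp
  have hAdet : A.det ≠ 0 := by
    intro h
    obtain ⟨y, hy, hAy⟩ := Matrix.exists_mulVec_eq_zero_iff.2 h
    have h0 : m y = 0 := by rw [← hA0, hAy]; rfl
    have hs (i : Fin d) : L i.succ ⬝ᵥ y = 0 := by
      have := congrFun hAy i.succ
      rw [hAs, h0, sub_zero] at this
      exact this
    refine hy (hLzero y fun i => Fin.cases ?_ hs i)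
    have := hsum y
    simpa [hs, h0] using this
  have hnn (u) (hu : u ∈ U) (i) : 0 ≤ L i ⬝ᵥ hom u := (hL i).1 u hu
  have hpos (u) (hu : u ∈ U) : 0 < m (hom u) := by
    refine lt_of_le_of_ne (div_nonneg (Finset.sum_nonneg fun i _ => hnn u hu i) hd.le) ?_
    intro h
    have h1 : ∑ i, L i ⬝ᵥ hom u = 0 := by
      simpa [m, hd.ne'] using h.symm
    rw [Finset.sum_eq_zero_iff_of_nonneg fun i _ => hnn u hu i] at h1
    exact hom_ne_zero u (hLzero _ fun i => h1 i (Finset.mem_univ i))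
  refine ⟨A, hAdet, ?_, fun u hu => by rw [hA0]; exact hpos u hu, ?_, ?_⟩
  · have h1 : m (hom x) = 1 := by
      have : ∀ i, L i ⬝ᵥ hom x = 1 := fun i => (hL i).2
      simp [m, this, hd.ne']
    funext i
    refine Fin.cases ?_ (fun i => ?_) i
    · rw [hA0, h1]; rfl
    · rw [hAs, h1, (hL i.succ).2]; simp
  · rintro _ ⟨u, hu, rfl⟩
    rw [mem_closedBall_zero_iff]
    refine norm_le_outerRadius fun i => ?_
    have hm := hpos u hu
    simp only [fracLin, dehom_apply, hA0, hAs]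
    rw [sub_div, div_self hm.ne', abs_le]
    have h1 : 0 ≤ L i.succ ⬝ᵥ hom u / m (hom u) := div_nonneg (hnn u hu _) hm.le
    have h2 : L i.succ ⬝ᵥ hom u / m (hom u) ≤ d + 1 := by
      rw [div_le_iff₀ hm, ← hsum]
      have := Finset.single_le_sum (fun j _ => hnn u hu (Fin.succ j)) (Finset.mem_univ i)
      linarith [hnn u hu 0]
    constructor <;> linarith
  · intro z hz
    rw [mem_ball_zero_iff] at hz
    have hunit : IsUnit A.det := isUnit_iff_ne_zero.2 hAdet
    let y := A⁻¹.mulVec (hom z)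
    have hAy : A.mulVec y = hom z := by
      simp [y, Matrix.mulVec_mulVec, Matrix.mul_nonsing_inv _ hunit]
    have hm : m y = 1 := by rw [← hA0, hAy]; rfl
    have hs (i : Fin d) : L i.succ ⬝ᵥ y = 1 + z i := by
      have := congrFun hAy i.succ
      rw [hAs, hm, hom_succ] at this
      linarith
    have h0 : L 0 ⬝ᵥ y = 1 - ∑ i, z i := by
      have := hsum y
      simp only [hs, hm, Finset.sum_add_distrib, Finset.sum_const, Finset.card_univ,
        Fintype.card_fin, nsmul_eq_mul, mul_one] at this
      linarith
    have hzs : ∑ i, |z i| < 1 / 2 := by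
      calc ∑ i, |z i| ≤ ∑ _i : Fin d, ‖z‖ := Finset.sum_le_sum fun i _ => PiLp.norm_apply_le z i
        _ = d * ‖z‖ := by simp
        _ ≤ (d + 1) * ‖z‖ := mul_le_mul_of_nonneg_right (by linarith) (norm_nonneg _)
        _ < (d + 1) * innerRadius d := mul_lt_mul_of_pos_left hz hd
        _ = 1 / 2 := by unfold innerRadius; field_simp
    obtain ⟨hy0, hyU⟩ : 0 < y 0 ∧ dehom y ∈ U := by
      refine mem_cone_of_dualSlice_pos hU hc hx fun a ha => ?_
      obtain ⟨c, rfl, hc1, hcs⟩ := hcoord a ha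
      rw [Fin.sum_univ_succ] at hcs
      -- The vector `y` above `z` has `L i.succ ⬝ᵥ y = 1 + z i`, and `L 0 ⬝ᵥ y = 1 - ∑ z i` since
      -- the mean is `1`; the constant terms add up to `∑ c i = 1`.
      have h1 : (∑ i, c i • L i) ⬝ᵥ y = 1 - c 0 * ∑ i, z i + ∑ i : Fin d, c i.succ * z i := by
        rw [sum_dotProduct, Fin.sum_univ_succ]
        simp only [smul_dotProduct, smul_eq_mul, hs, h0, mul_add, mul_one, Finset.sum_add_distrib]
        linear_combination hcs
      have h2 : |c 0 * ∑ i, z i| ≤ ∑ i, |z i| := by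
        rw [abs_mul]
        exact (mul_le_of_le_one_left (abs_nonneg _) (hc1 0)).trans
          (Finset.abs_sum_le_sum_abs _ _)
      have h3 : |∑ i : Fin d, c i.succ * z i| ≤ ∑ i, |z i| := by
        refine (Finset.abs_sum_le_sum_abs _ _).trans (Finset.sum_le_sum fun i _ => ?_)
        rw [abs_mul]
        exact mul_le_of_le_one_left (abs_nonneg _) (hc1 _)
      rw [h1]
      linarith [(abs_le.1 h2).2, (abs_le.1 h3).1]
    refine ⟨dehom y, hyU, ?_⟩
    have h1 : hom (dehom y) = (y 0)⁻¹ • y := by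
      rw [eq_inv_smul_iff₀ hy0.ne', smul_hom_dehom hy0.ne']
    rw [fracLin, h1, Matrix.mulVec_smul, hAy, dehom_smul_hom (inv_ne_zero hy0.ne')]

/-! ### Exit times of half-lines -/

/-- The time at which the half-line from `x` with velocity `v` leaves `U`. -/
noncomputable def exitTime (U : Set (Euc d)) (x v : Euc d) : ℝ :=
  sSup {t : ℝ | 0 ≤ t ∧ x + t • v ∈ U}

theorem exitPoint_eq (U : Set (Euc d)) (x v : Euc d) :
    exitPoint U x v = x + exitTime U x v • v := rfl

theorem bddAbove_exitTime {U : Set (Euc d)} (hb : Bornology.IsBounded U) (x : Euc d) {v : Euc d}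
    (hv : v ≠ 0) : BddAbove {t : ℝ | 0 ≤ t ∧ x + t • v ∈ U} := by
  obtain ⟨M, hM⟩ := hb.subset_ball x
  refine ⟨M / ‖v‖, fun t ht => ?_⟩
  have := hM ht.2
  rw [mem_ball_iff_norm, add_sub_cancel_left, norm_smul, Real.norm_of_nonneg ht.1] at this
  rw [le_div_iff₀ (norm_pos_iff.2 hv)]
  exact this.le

theorem le_exitTime {U : Set (Euc d)} (hb : Bornology.IsBounded U) {x v : Euc d} (hv : v ≠ 0)
    {t : ℝ} (ht : 0 ≤ t) (h : x + t • v ∈ U) : t ≤ exitTime U x v :=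
  le_csSup (bddAbove_exitTime hb x hv) ⟨ht, h⟩

theorem exitTime_nonneg (U : Set (Euc d)) (x v : Euc d) : 0 ≤ exitTime U x v :=
  Real.sSup_nonneg fun _ ht => ht.1

theorem lt_exitTime {U : Set (Euc d)} (hU : IsOpen U) (hb : Bornology.IsBounded U) {x v : Euc d}
    (hv : v ≠ 0) {t : ℝ} (ht : 0 ≤ t) (h : x + t • v ∈ U) : t < exitTime U x v := by
  have hcont : Continuous fun s : ℝ => x + s • v := by fun_prop
  have h1 : ∀ᶠ s in 𝓝[>] t, x + s • v ∈ U :=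
    (hcont.continuousAt.eventually (hU.mem_nhds h)).filter_mono nhdsWithin_le_nhds
  obtain ⟨s, hs, hts⟩ := (h1.and self_mem_nhdsWithin).exists
  exact lt_of_lt_of_le hts (le_exitTime hb hv (ht.trans (le_of_lt hts)) hs)

theorem add_exitTime_notMem {U : Set (Euc d)} (hU : IsOpen U) (hb : Bornology.IsBounded U)
    {x v : Euc d} (hv : v ≠ 0) : x + exitTime U x v • v ∉ U := fun h =>
  lt_irrefl _ (lt_exitTime hU hb hv (exitTime_nonneg U x v) h)

theorem exitTime_pos {U : Set (Euc d)} (hU : IsOpen U) (hb : Bornology.IsBounded U) {x v : Euc d}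
    (hx : x ∈ U) (hv : v ≠ 0) : 0 < exitTime U x v :=
  lt_exitTime hU hb hv le_rfl (by simpa using hx)

theorem mem_of_lt_exitTime {U : Set (Euc d)} (hc : Convex ℝ U) {x v : Euc d} (hx : x ∈ U) {t : ℝ}
    (ht : 0 ≤ t) (h : t < exitTime U x v) : x + t • v ∈ U := by
  obtain ⟨s, ⟨-, hs⟩, hts⟩ := exists_lt_of_lt_csSup
    (s := {t : ℝ | 0 ≤ t ∧ x + t • v ∈ U}) ⟨0, le_rfl, by simpa using hx⟩ h
  have hs0 : 0 < s := ht.trans_lt hts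
  have := hc.add_smul_sub_mem hx hs ⟨div_nonneg ht hs0.le, (div_le_one hs0).2 hts.le⟩
  rwa [add_sub_cancel_left, smul_smul, div_mul_cancel₀ _ hs0.ne'] at this

/-! ### Derivative of projective transformations -/

/-- The linear part of the affine function `u ↦ a · (1, u)`. -/
noncomputable def linPart (a : Fin (d + 1) → ℝ) : Euc d →L[ℝ] ℝ :=
  ∑ i : Fin d, a i.succ • EuclideanSpace.proj i

theorem dotProduct_hom_eq (a : Fin (d + 1) → ℝ) (u : Euc d) :
    a ⬝ᵥ hom u = a 0 + linPart a u := by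
  simp [dotProduct_hom, linPart]

theorem mulVec_hom_add (A : Matrix (Fin (d + 1)) (Fin (d + 1)) ℝ) (x v : Euc d) (t : ℝ)
    (i : Fin (d + 1)) :
    A.mulVec (hom (x + t • v)) i = A.mulVec (hom x) i + t * linPart (A i) v := by
  simp only [Matrix.mulVec]
  rw [dotProduct_hom_eq, dotProduct_hom_eq, map_add, map_smul, smul_eq_mul, add_assoc]

theorem hasFDerivAt_mulVec_hom (A : Matrix (Fin (d + 1)) (Fin (d + 1)) ℝ) (i : Fin (d + 1))
    (u : Euc d) : HasFDerivAt (fun u => A.mulVec (hom u) i) (linPart (A i)) u := by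
  have : (fun u => A.mulVec (hom u) i) = fun u => A i 0 + linPart (A i) u :=
    funext fun u => dotProduct_hom_eq (A i) u
  rw [this]
  exact (linPart (A i)).hasFDerivAt.const_add _

theorem contDiff_mulVec_hom (A : Matrix (Fin (d + 1)) (Fin (d + 1)) ℝ) (i : Fin (d + 1)) :
    ContDiff ℝ 1 fun u : Euc d => A.mulVec (hom u) i := by
  have : (fun u => A.mulVec (hom u) i) = fun u => A i 0 + linPart (A i) u :=
    funext fun u => dotProduct_hom_eq (A i) u
  rw [this]
  exact contDiff_const.add (linPart (A i)).contDiff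

theorem contDiffOn_fracLin (A : Matrix (Fin (d + 1)) (Fin (d + 1)) ℝ) :
    ContDiffOn ℝ 1 (fracLin A) {u | A.mulVec (hom u) 0 ≠ 0} := by
  rw [contDiffOn_euclidean]
  intro i
  simp only [fracLin, dehom_apply]
  exact (contDiff_mulVec_hom A _).contDiffOn.div (contDiff_mulVec_hom A _).contDiffOn fun u hu => hu

/-- The linear part of the projective transformation `A`. -/
noncomputable def linMap (A : Matrix (Fin (d + 1)) (Fin (d + 1)) ℝ) : Euc d →L[ℝ] Euc d :=
  ((EuclideanSpace.equiv (Fin d) ℝ).symm : (Fin d → ℝ) →L[ℝ] Euc d).comp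
    (ContinuousLinearMap.pi fun i : Fin d => linPart (A i.succ))

@[simp] theorem linMap_apply (A : Matrix (Fin (d + 1)) (Fin (d + 1)) ℝ) (v : Euc d) (i : Fin d) :
    linMap A v i = linPart (A i.succ) v := rfl

theorem fracLin_injOn {A : Matrix (Fin (d + 1)) (Fin (d + 1)) ℝ} (hA : A.det ≠ 0) :
    InjOn (fracLin A) {u | A.mulVec (hom u) 0 ≠ 0} := by
  intro u hu w hw h
  have hu' := smul_hom_dehom hu
  have hw' := smul_hom_dehom hw
  change _ • hom (fracLin A u) = _ at hu'
  change _ • hom (fracLin A w) = _ at hw'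
  have h0 : A.mulVec (A.mulVec (hom w) 0 • hom u) = A.mulVec (A.mulVec (hom u) 0 • hom w) := by
    rw [Matrix.mulVec_smul, Matrix.mulVec_smul, ← hu', ← hw', h, smul_comm]
    simp
  have h1 := Matrix.mulVec_injective_of_isUnit
    ((Matrix.isUnit_iff_isUnit_det A).2 (isUnit_iff_ne_zero.2 hA)) h0
  have h2 : A.mulVec (hom w) 0 = A.mulVec (hom u) 0 := by simpa using congrFun h1 0
  rw [h2] at h1
  exact hom_injective (smul_right_injective _ hu h1)

namespace Normalizes

variable {A : Matrix (Fin (d + 1)) (Fin (d + 1)) ℝ} {U : Set (Euc d)} {x : Euc d}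

theorem mulVec_zero (h : Normalizes A U x) (v : Euc d) (t : ℝ) :
    A.mulVec (hom (x + t • v)) 0 = 1 + t * linPart (A 0) v := by
  rw [mulVec_hom_add, h.map_base, hom_zero]

/-- A projective map sends lines to lines: the line through `x` directed by `v` becomes the line
through `0` directed by `linMap A v`, with time reparametrised by a homography. -/
theorem fracLin_add (h : Normalizes A U x) (v : Euc d) (t : ℝ) :
    fracLin A (x + t • v) = (t / (1 + t * linPart (A 0) v)) • linMap A v := by
  ext i
  simp only [fracLin, dehom_apply, h.mulVec_zero, PiLp.smul_apply, linMap_apply, smul_eq_mul]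
  rw [mulVec_hom_add, h.map_base, hom_succ]
  simp
  ring

theorem fracLin_base (h : Normalizes A U x) : fracLin A x = 0 := by
  simpa using h.fracLin_add 0 0

theorem injOn (h : Normalizes A U x) : InjOn (fracLin A) U :=
  (fracLin_injOn h.det_ne_zero).mono fun u hu => (h.pos u hu).ne'

/-- At `x` the numerators vanish and the denominator is `1`, so the quotient rule leaves only the
derivative of the numerators. -/
theorem hasFDerivAt (h : Normalizes A U x) : HasFDerivAt (fracLin A) (linMap A) x := by
  rw [← hasFDerivWithinAt_univ, hasFDerivWithinAt_euclidean]
  intro i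
  rw [hasFDerivWithinAt_univ]
  have h0 : A.mulVec (hom x) 0 = 1 := by rw [h.map_base]; rfl
  have hi : A.mulVec (hom x) i.succ = 0 := by rw [h.map_base]; rfl
  have hinv := (hasDerivAt_inv (h0 ▸ one_ne_zero : A.mulVec (hom x) 0 ≠ 0)).comp_hasFDerivAt x
    (hasFDerivAt_mulVec_hom A 0 x)
  have := (hasFDerivAt_mulVec_hom A i.succ x).mul hinv
  rw [Function.comp_apply, h0, hi] at this
  have hfun : (fun u => fracLin A u i) = (fun u => A.mulVec (hom u) i.succ) *
      ((fun y => y⁻¹) ∘ fun u => A.mulVec (hom u) 0) := funext fun u => div_eq_mul_inv _ _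
  rw [hfun]
  refine this.congr_fderiv ?_
  ext v
  simp

/-- Otherwise `A` would send every vector above the line `x + ℝ v` to a multiple of `hom 0`, against
injectivity. -/
theorem linMap_ne_zero (h : Normalizes A U x) {v : Euc d} (hv : v ≠ 0) : linMap A v ≠ 0 := by
  intro hT
  set α := linPart (A 0) v
  have hw (t : ℝ) : A.mulVec (hom (x + t • v)) = (1 + t * α) • hom 0 := by
    funext i
    refine Fin.cases ?_ (fun i => ?_) i
    · rw [h.mulVec_zero]; simp [α]
    · rw [mulVec_hom_add, h.map_base, ← linMap_apply, hT]; simp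
  have h1 : A.mulVec (hom (x + (1 : ℝ) • v)) = A.mulVec ((1 + α) • hom x) := by
    rw [hw, Matrix.mulVec_smul, h.map_base, one_mul]
  have h2 := Matrix.mulVec_injective_of_isUnit
    ((Matrix.isUnit_iff_isUnit_det A).2 (isUnit_iff_ne_zero.2 h.det_ne_zero)) h1
  have h3 : α = 0 := by simpa using congrFun h2 0
  rw [h3, add_zero, one_smul, one_smul] at h2
  exact hv (by simpa using (hom_injective h2))

theorem det_linMap_ne_zero (h : Normalizes A U x) :
    LinearMap.det (linMap A : Euc d →ₗ[ℝ] Euc d) ≠ 0 := by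
  intro hdet
  refine (LinearMap.bot_lt_ker_of_det_eq_zero hdet).ne' (LinearMap.ker_eq_bot'.2 fun v hv => ?_)
  by_contra hne
  exact h.linMap_ne_zero hne hv

/-! ### Comparison of the Busemann density with the Jacobian of a normalisation -/

/-- At the exit time `s` the image point has norm `s ‖linMap A v‖ / (1 + s α)`, where `α = linPart
(A 0) v`, and it lies between the two balls; dividing by `s` gives the bounds. The term `α` is odd
in `v`, so it disappears from the Finsler norm. -/
theorem exitTime_bounds (h : Normalizes A U x) (hU : IsOpen U) (hc : Convex ℝ U)
    (hb : Bornology.IsBounded U) (hx : x ∈ U) {v : Euc d} (hv : v ≠ 0) :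
    ‖linMap A v‖ / outerRadius d ≤ 1 / exitTime U x v + linPart (A 0) v ∧
      1 / exitTime U x v + linPart (A 0) v ≤ ‖linMap A v‖ / innerRadius d := by
  have hs : 0 < exitTime U x v := exitTime_pos hU hb hx hv
  set s := exitTime U x v with hs_def
  set α := linPart (A 0) v
  have hR := outerRadius_pos d
  have hr := innerRadius_pos d
  have hnorm (t : ℝ) (ht : 0 ≤ t) (ht' : 0 < 1 + t * α) :
      ‖fracLin A (x + t • v)‖ = t * ‖linMap A v‖ / (1 + t * α) := by
    rw [h.fracLin_add, norm_smul, Real.norm_of_nonneg (div_nonneg ht ht'.le)]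
    ring
  have h1 : s * ‖linMap A v‖ ≤ outerRadius d * (1 + s * α) := by
    -- The bound holds for `t < s`, where the point is in `U`; cleared of denominators, it is a
    -- closed condition and passes to `t = s`.
    have hcl : IsClosed {t : ℝ | t * ‖linMap A v‖ ≤ outerRadius d * (1 + t * α)} :=
      isClosed_le (by fun_prop) (by fun_prop)
    have hsub : Ico 0 s ⊆ {t : ℝ | t * ‖linMap A v‖ ≤ outerRadius d * (1 + t * α)} := by
      intro t ht
      have hmem := mem_of_lt_exitTime hc hx ht.1 ht.2
      have hp := h.pos _ hmem
      rw [h.mulVec_zero] at hp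
      have := h.image_subset (mem_image_of_mem _ hmem)
      rw [mem_closedBall_zero_iff, hnorm t ht.1 hp, div_le_iff₀ hp] at this
      exact this
    have := hcl.closure_subset_iff.2 hsub
    rw [closure_Ico hs.ne] at this
    exact this ⟨hs.le, le_rfl⟩
  have h2 : innerRadius d * (1 + s * α) ≤ s * ‖linMap A v‖ := by
    by_contra hlt
    rw [not_le] at hlt
    have hp : 0 < 1 + s * α :=
      pos_of_mul_pos_right (lt_of_le_of_lt (by positivity) hlt) hr.le
    have hball : fracLin A (x + s • v) ∈ Metric.ball (0 : Euc d) (innerRadius d) := by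
      rw [mem_ball_zero_iff, hnorm s hs.le hp, div_lt_iff₀ hp]
      exact hlt
    -- The inner ball is covered by the image of `U`, so by injectivity the exit point would belong
    -- to the open set `U`.
    obtain ⟨u, hu, hue⟩ := h.subset_image hball
    have := fracLin_injOn h.det_ne_zero (h.pos u hu).ne'
      (show A.mulVec (hom (x + s • v)) 0 ≠ 0 by rw [h.mulVec_zero]; exact hp.ne') hue
    exact add_exitTime_notMem hU hb hv (this ▸ hu)
  have h3 : 1 / s + α = (1 + s * α) / s := by field_simp
  rw [h3, div_le_div_iff₀ hR hs, div_le_div_iff₀ hs hr]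
  constructor <;> linarith

theorem finsler_bounds (h : Normalizes A U x) (hU : IsOpen U) (hc : Convex ℝ U)
    (hb : Bornology.IsBounded U) (hx : x ∈ U) (v : Euc d) :
    ‖linMap A v‖ / outerRadius d ≤ affineFinsler U x v ∧
      affineFinsler U x v ≤ ‖linMap A v‖ / innerRadius d := by
  by_cases hv : v = 0
  · subst hv; simp [affineFinsler]
  have hv' : -v ≠ 0 := neg_ne_zero.2 hv
  have hn := norm_pos_iff.2 hv
  have hF : affineFinsler U x v = (1 / exitTime U x (-v) + 1 / exitTime U x v) / 2 := by
    have h1 := exitTime_pos hU hb hx hv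
    have h2 := exitTime_pos hU hb hx hv'
    rw [affineFinsler, exitPoint_eq, exitPoint_eq, dist_self_add_right, dist_self_add_right,
      norm_smul, norm_smul, norm_neg, Real.norm_of_nonneg h1.le, Real.norm_of_nonneg h2.le]
    field_simp
  -- Averaging the bounds for `v` and `-v` cancels `linPart (A 0) v`.
  have h1 := h.exitTime_bounds hU hc hb hx hv
  have h2 := h.exitTime_bounds hU hc hb hx hv'
  rw [map_neg, map_neg, norm_neg] at h2
  rw [hF]
  constructor <;> linarith

theorem volume_preimage_ball (h : Normalizes A U x) {ρ : ℝ} (hρ : 0 < ρ) :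
    volume (Metric.ball (0 : Euc d) 1) / volume (linMap A ⁻¹' Metric.ball 0 ρ) =
      ENNReal.ofReal (|(linMap A).det| / ρ ^ d) := by
  have hdet := h.det_linMap_ne_zero
  have hω := (Metric.measure_ball_pos volume (0 : Euc d) one_pos).ne'
  have hω' := (measure_ball_lt_top (μ := volume) (x := (0 : Euc d)) (r := 1)).ne
  rw [Measure.addHaar_preimage_continuousLinearMap volume hdet,
    Measure.addHaar_ball_of_pos volume _ hρ, finrank_euclideanSpace_fin, ← mul_assoc,
    ← ENNReal.ofReal_mul (abs_nonneg _)]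
  have hpos : 0 < |(LinearMap.det (linMap A : Euc d →ₗ[ℝ] Euc d))⁻¹| * ρ ^ d := by positivity
  set ω := volume (Metric.ball (0 : Euc d) 1)
  rw [ENNReal.div_eq_inv_mul, ENNReal.mul_inv (.inr hω') (.inr hω), mul_assoc,
    ENNReal.inv_mul_cancel hω hω', mul_one, ← ENNReal.ofReal_inv_of_pos hpos]
  congr 1
  rw [mul_inv, abs_inv, inv_inv]
  rfl

/-- The Finsler unit ball lies between the preimages under `linMap A` of the balls of radii
`innerRadius d` and `outerRadius d`, whose volumes are explicit. -/
theorem busemann_density_bounds (h : Normalizes A U x) (hU : IsOpen U) (hc : Convex ℝ U)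
    (hb : Bornology.IsBounded U) (hx : x ∈ U) :
    ENNReal.ofReal (|(linMap A).det| / outerRadius d ^ d) ≤
        volume (Metric.ball (0 : Euc d) 1) / volume {v : Euc d | affineFinsler U x v < 1} ∧
      volume (Metric.ball (0 : Euc d) 1) / volume {v : Euc d | affineFinsler U x v < 1} ≤
        ENNReal.ofReal (|(linMap A).det| / innerRadius d ^ d) := by
  rw [← h.volume_preimage_ball (outerRadius_pos d), ← h.volume_preimage_ball (innerRadius_pos d)]
  constructor
  · refine ENNReal.div_le_div_left (measure_mono fun v hv => ?_) _
    have := (h.finsler_bounds hU hc hb hx v).1.trans_lt hv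
    rw [div_lt_one (outerRadius_pos d)] at this
    simpa using this
  · refine ENNReal.div_le_div_left (measure_mono fun v hv => ?_) _
    refine (h.finsler_bounds hU hc hb hx v).2.trans_lt ?_
    rw [div_lt_one (innerRadius_pos d)]
    simpa using hv

end Normalizes

/-! ### Transformation of densities under projective transformations -/

theorem isOpenEmbedding_affineChart (g : PGLGroup d) : IsOpenEmbedding (affineChart g) := by
  refine .of_continuous_injective_isOpenMap (continuous_affineChart g) (affineChart_injective g) ?_
  intro V hV
  have : affineChart g '' V = g • (stdChart d '' V) := by
    rw [← Set.image_smul, Set.image_image]; rfl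
  rw [this]
  exact isOpen_smul_pgl g (isOpen_stdChart_image hV)

theorem measurableEmbedding_affineChart (g : PGLGroup d) : MeasurableEmbedding (affineChart g) :=
  (isOpenEmbedding_affineChart g).measurableEmbedding

theorem measurableEmbedding_smul_pgl (g : PGLGroup d) :
    MeasurableEmbedding fun p : RP d => g • p :=
  (Homeomorph.mk (MulAction.toPerm g) (continuous_smul_pgl g)
    (continuous_smul_pgl g⁻¹)).measurableEmbedding

namespace ProperConvex

variable (Ω : ProperConvex d)

theorem subset_range_chart : Ω.1 ⊆ range (affineChart Ω.chart) := Ω.2.2.2.choose_spec.1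

theorem convex_affine : Convex ℝ Ω.affine := Ω.2.2.2.choose_spec.2.1

theorem isBounded_affine : Bornology.IsBounded Ω.affine := Ω.2.2.2.choose_spec.2.2

theorem isOpen_affine : IsOpen Ω.affine := Ω.2.1.preimage (continuous_affineChart _)

theorem image_affine : affineChart Ω.chart '' Ω.affine = Ω.1 :=
  image_preimage_eq_of_subset Ω.subset_range_chart

theorem nonempty_affine : Ω.affine.Nonempty := by
  have := Ω.2.2.1
  rw [← Ω.image_affine] at this
  exact this.of_image

end ProperConvex

/-! ### Images of convex sets under projective maps -/

theorem isProperlyConvexOpen_stdChart_image {V : Set (Euc d)} (hV : IsOpen V) (hne : V.Nonempty)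
    (hc : Convex ℝ V) (hb : Bornology.IsBounded V) : IsProperlyConvexOpen (stdChart d '' V) := by
  refine ⟨isOpen_stdChart_image hV, hne.image _, 1, ?_⟩
  rw [affineChart_one, preimage_image_eq _ stdChart_injective]
  exact ⟨image_subset_range _ _, hc, hb⟩

theorem smul_stdChart {A : Matrix (Fin (d + 1)) (Fin (d + 1)) ℝ} (hA : A.det ≠ 0) {u : Euc d}
    (hu : A.mulVec (hom u) 0 ≠ 0) :
    (Matrix.ProjGenLinGroup.mk (Matrix.GeneralLinearGroup.mkOfDetNeZero A hA) : PGLGroup d) •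
      stdChart d u = stdChart d (fracLin A u) :=
  (mk_eq_stdChart_iff' _ _ _).2 ⟨hu, rfl⟩

/-- Where the denominator is positive, segments go to segments: the preimage of the barycentre with
weights `s, t` has weights proportional to `s / α, t / β`, with `α, β` the denominators at the
endpoints. -/
theorem convex_fracLin_image {A : Matrix (Fin (d + 1)) (Fin (d + 1)) ℝ} {U : Set (Euc d)}
    (hc : Convex ℝ U) (hpos : ∀ u ∈ U, 0 < A.mulVec (hom u) 0) : Convex ℝ (fracLin A '' U) := by
  rintro _ ⟨u, hu, rfl⟩ _ ⟨w, hw, rfl⟩ s t hs ht hst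
  have hα := hpos u hu
  have hβ := hpos w hw
  set α := A.mulVec (hom u) 0
  set β := A.mulVec (hom w) 0
  have hsum : 0 < s / α + t / β := by
    rcases hs.eq_or_lt with h0 | h0
    · have : 0 < t := by linarith
      positivity
    · positivity
  set c := s / α + t / β
  have hp : (s / α / c) • u + (t / β / c) • w ∈ U :=
    hc hu hw (by positivity) (by positivity) (by rw [← add_div]; exact div_self hsum.ne')
  refine ⟨_, hp, ?_⟩
  have h1 : c • hom ((s / α / c) • u + (t / β / c) • w) = (s / α) • hom u + (t / β) • hom w := by
    ext i
    refine Fin.cases ?_ (fun i => ?_) i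
    · simp [c]
    · simp only [Pi.smul_apply, Pi.add_apply, hom_succ, PiLp.add_apply, PiLp.smul_apply,
        smul_eq_mul]
      field_simp
  have hu' : A.mulVec (hom u) = α • hom (fracLin A u) := (smul_hom_dehom hα.ne').symm
  have hw' : A.mulVec (hom w) = β • hom (fracLin A w) := (smul_hom_dehom hβ.ne').symm
  have h2 : c • A.mulVec (hom ((s / α / c) • u + (t / β / c) • w)) =
      hom (s • fracLin A u + t • fracLin A w) := by
    rw [← Matrix.mulVec_smul, h1, Matrix.mulVec_add, Matrix.mulVec_smul, Matrix.mulVec_smul,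
      hu', hw', smul_smul, smul_smul, div_mul_cancel₀ _ hα.ne', div_mul_cancel₀ _ hβ.ne']
    ext i
    refine Fin.cases ?_ (fun i => ?_) i
    · simp [hst]
    · simp
  have h3 : A.mulVec (hom ((s / α / c) • u + (t / β / c) • w)) =
      c⁻¹ • hom (s • fracLin A u + t • fracLin A w) := by
    rw [← h2, smul_smul, inv_mul_cancel₀ hsum.ne', one_smul]
  rw [fracLin, h3, dehom_smul_hom (inv_ne_zero hsum.ne')]

/-- Normalised properly convex open sets: the image of `Ω` under a normalising transformation. -/
theorem Normalizes.exists_properConvex {Ω : ProperConvex d} {x : Euc d}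
    {A : Matrix (Fin (d + 1)) (Fin (d + 1)) ℝ} (h : Normalizes A Ω.affine x) :
    ∃ (k : PGLGroup d) (Ω' : ProperConvex d), Ω'.1 = k • Ω.1 ∧
      Ω'.1 = stdChart d '' (fracLin A '' Ω.affine) ∧
      ∀ u ∈ Ω.affine, k • affineChart Ω.chart u = stdChart d (fracLin A u) := by
  let k : PGLGroup d := Matrix.ProjGenLinGroup.mk
    (Matrix.GeneralLinearGroup.mkOfDetNeZero A h.det_ne_zero) * Ω.chart⁻¹
  have hk : ∀ u ∈ Ω.affine, k • affineChart Ω.chart u = stdChart d (fracLin A u) := fun u hu => by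
    rw [affineChart, ← mul_smul, inv_mul_cancel_right, smul_stdChart _ (h.pos u hu).ne']
  have himage : k • Ω.1 = stdChart d '' (fracLin A '' Ω.affine) := by
    rw [← Ω.image_affine, ← Set.image_smul, Set.image_image, Set.image_image]
    exact image_congr hk
  have hopen : IsOpen (fracLin A '' Ω.affine) := by
    rw [← preimage_image_eq (fracLin A '' Ω.affine) stdChart_injective, ← himage]
    exact (isOpen_smul_pgl k Ω.2.1).preimage continuous_stdChart
  refine ⟨k, ⟨stdChart d '' (fracLin A '' Ω.affine), isProperlyConvexOpen_stdChart_image hopen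
    (Ω.nonempty_affine.image _) (convex_fracLin_image Ω.convex_affine h.pos)
    (Metric.isBounded_closedBall.subset h.image_subset)⟩, himage.symm, rfl, hk⟩

/-- Invariance and the change of variables formula identify the integrals over every measurable set
of `f₀` and of the Jacobian times `f₁ ∘ fracLin A`. The two functions agree almost everywhere, hence
at `x` by continuity; there the Jacobian is that of `linMap A`. -/
theorem IsNaturalVolume.density_eq {μ : ProperConvex d → Measure (RP d)} (hμ : IsNaturalVolume μ)
    {Ω Ω' : ProperConvex d} {x : Euc d} {A : Matrix (Fin (d + 1)) (Fin (d + 1)) ℝ}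
    (h : Normalizes A Ω.affine x) (hx : x ∈ Ω.affine) {k : PGLGroup d} (hΩ' : Ω'.1 = k • Ω.1)
    (hk : ∀ u ∈ Ω.affine, k • affineChart Ω.chart u = stdChart d (fracLin A u))
    {f₀ f₁ : Euc d → ℝ} (hf₀ : ContinuousOn f₀ Ω.affine)
    (hf₁ : ContinuousOn f₁ (fracLin A '' Ω.affine))
    (h₀ : μ Ω = ((volume.restrict Ω.affine).withDensity fun u => ENNReal.ofReal (f₀ u)).map
      (affineChart Ω.chart))
    (h₁ : μ Ω' = ((volume.restrict (fracLin A '' Ω.affine)).withDensity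
      fun u => ENNReal.ofReal (f₁ u)).map (stdChart d)) :
    ENNReal.ofReal (f₀ x) = ENNReal.ofReal |(linMap A).det| * ENNReal.ofReal (f₁ 0) := by
  set U := Ω.affine
  have hUo : IsOpen U := Ω.isOpen_affine
  have hdiff : ContDiffOn ℝ 1 (fracLin A) U :=
    (contDiffOn_fracLin A).mono fun u hu => (h.pos u hu).ne'
  have hder : ∀ u ∈ U, HasFDerivAt (fracLin A) (fderiv ℝ (fracLin A) u) u := fun u hu =>
    ((hdiff.differentiableOn one_ne_zero).differentiableAt (hUo.mem_nhds hu)).hasFDerivAt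
  have hdet : ContinuousOn (fun u => |(fderiv ℝ (fracLin A) u).det|) U :=
    (ContinuousLinearMap.continuous_det.comp_continuousOn
      (hdiff.continuousOn_fderiv_of_isOpen hUo le_rfl)).abs
  have hstd : MeasurableEmbedding (stdChart d) := by
    rw [← affineChart_one]; exact measurableEmbedding_affineChart 1
  have hmeasV : MeasurableSet (fracLin A '' U) :=
    measurable_image_of_fderivWithin hUo.measurableSet
      (fun u hu => (hder u hu).hasFDerivWithinAt) h.injOn
  have key (W : Set (Euc d)) (hW : MeasurableSet W) :
      ∫⁻ u in W, ENNReal.ofReal (f₀ u) ∂volume.restrict U =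
        ∫⁻ u in W, ENNReal.ofReal |(fderiv ℝ (fracLin A) u).det| *
          ENNReal.ofReal (f₁ (fracLin A u)) ∂volume.restrict U := by
    have hWU : MeasurableSet (W ∩ U) := hW.inter hUo.measurableSet
    have hsub : W ∩ U ⊆ U := inter_subset_right
    have hE : MeasurableSet (fracLin A '' (W ∩ U)) := measurable_image_of_fderivWithin hWU
      (fun u hu => (hder u hu.2).hasFDerivWithinAt) (h.injOn.mono hsub)
    have hpre : affineChart Ω.chart ⁻¹' ((fun p => k • p) ⁻¹'
        (stdChart d '' (fracLin A '' (W ∩ U)))) = W ∩ U := by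
      ext u
      simp only [mem_preimage, mem_image, exists_exists_and_eq_and]
      constructor
      · rintro ⟨w, hw, hwu⟩
        rw [← hk w hw.2] at hwu
        rwa [← affineChart_injective _ (MulAction.injective k hwu)]
      · exact fun hu => ⟨u, hu, (hk u hu.2).symm⟩
    have h2 := congrArg (fun ν => ν (stdChart d '' (fracLin A '' (W ∩ U))))
      (hμ.invariant k Ω Ω' hΩ')
    rw [(measurableEmbedding_smul_pgl k).map_apply, h₀,
      (measurableEmbedding_affineChart _).map_apply, hpre, h₁, hstd.map_apply,
      preimage_image_eq _ stdChart_injective, withDensity_apply _ hE, withDensity_apply _ hWU,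
      Measure.restrict_restrict hE, Measure.restrict_restrict hWU,
      inter_eq_left.2 (image_mono hsub), inter_eq_left.2 hsub,
      lintegral_image_eq_lintegral_abs_det_fderiv_mul volume hWU
        (fun u hu => (hder u hu.2).hasFDerivWithinAt) (h.injOn.mono hsub)] at h2
    rw [Measure.restrict_restrict hW]
    exact h2.symm
  have hc₀ : ContinuousOn (fun u => ENNReal.ofReal (f₀ u)) U :=
    ENNReal.continuous_ofReal.comp_continuousOn hf₀
  have hc₁ : ContinuousOn (fun u => ENNReal.ofReal |(fderiv ℝ (fracLin A) u).det| *
      ENNReal.ofReal (f₁ (fracLin A u))) U := by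
    simp only [← ENNReal.ofReal_mul (abs_nonneg _)]
    exact ENNReal.continuous_ofReal.comp_continuousOn
      (hdet.mul (hf₁.comp hdiff.continuousOn (mapsTo_image _ _)))
  have hae := ae_eq_of_forall_setLIntegral_eq_of_sigmaFinite₀ (hc₀.aemeasurable hUo.measurableSet)
    (hc₁.aemeasurable hUo.measurableSet) fun W hW _ => key W hW
  have := Measure.eqOn_open_of_ae_eq hae hUo hc₀ hc₁ hx
  simp only at this
  rw [this, h.hasFDerivAt.fderiv, h.fracLin_base]

/-! ### Compactness of the space of normalised convex sets -/

open TopologicalSpace in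
-- Non-convexity is open: if `a x + b y` is outside `K`, separate it from `K`; any compact set
-- inside the neighbourhood of `K` that also meets small neighbourhoods of `x` and `y` has the same
-- defect.
theorem isClosed_convex_compacts : IsClosed {K : Compacts (Euc d) | Convex ℝ (K : Set (Euc d))} := by
  rw [← isOpen_compl_iff, isOpen_iff_forall_mem_open]
  intro K hK
  simp only [mem_compl_iff, mem_ofPred_eq, Convex, StarConvex, not_forall] at hK
  obtain ⟨x, hx, y, hy, a, b, ha, hb, hab, hz⟩ := hK
  obtain ⟨W, V, hW, hV, hKW, hzV, hWV⟩ :=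
    SeparatedNhds.of_isCompact_isCompact K.isCompact (isCompact_singleton (x := a • x + b • y))
      (disjoint_singleton_right.2 hz)
  have hcont : Continuous fun p : Euc d × Euc d => a • p.1 + b • p.2 := by fun_prop
  obtain ⟨P, Q, hP, hQ, hxP, hyQ, hPQ⟩ :=
    isOpen_prod_iff.1 (hV.preimage hcont) x y (hzV rfl)
  refine ⟨{L | (L : Set (Euc d)) ⊆ W} ∩ ({L | ((L : Set (Euc d)) ∩ P).Nonempty} ∩
    {L | ((L : Set (Euc d)) ∩ Q).Nonempty}), ?_, ?_, hKW, ⟨x, hx, hxP⟩, ⟨y, hy, hyQ⟩⟩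
  · rintro L ⟨hLW, ⟨p, hpL, hpP⟩, ⟨q, hqL, hqQ⟩⟩ hconv
    exact hWV.notMem_of_mem_left (hLW (hconv hpL hqL ha hb hab))
      (hPQ (mk_mem_prod hpP hqQ))
  · exact (Compacts.isOpen_subsets_of_isOpen hW).inter
      ((Compacts.isOpen_inter_nonempty_of_isOpen hP).inter
        (Compacts.isOpen_inter_nonempty_of_isOpen hQ))

open TopologicalSpace in
/-- The compact convex sets between two given balls centred at the origin. -/
def convexBodies (d : ℕ) (r R : ℝ) : Set (Compacts (Euc d)) :=
  {K | Convex ℝ (K : Set (Euc d)) ∧ Metric.ball 0 r ⊆ (K : Set (Euc d)) ∧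
    (K : Set (Euc d)) ⊆ Metric.closedBall 0 R}

open TopologicalSpace in
-- Blaschke selection: the compact subsets of a closed ball form a compact space, and the other two
-- conditions are closed.
theorem isCompact_convexBodies (r R : ℝ) : IsCompact (convexBodies d r R) := by
  have h1 : IsClosed {K : Compacts (Euc d) | Metric.ball 0 r ⊆ (K : Set (Euc d))} := by
    have : {K : Compacts (Euc d) | Metric.ball 0 r ⊆ (K : Set (Euc d))} =
        ⋂ p ∈ Metric.ball (0 : Euc d) r, {K : Compacts (Euc d) | ((K : Set (Euc d)) ∩ {p}).Nonempty} := by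
      ext K; simp [subset_def]
    rw [this]
    exact isClosed_biInter fun p _ => Compacts.isClosed_inter_nonempty_of_isClosed isClosed_singleton
  exact (Compacts.isCompact_subsets_of_isCompact
    (isCompact_closedBall (0 : Euc d) R)).of_isClosed_subset
      (isClosed_convex_compacts.inter
        (h1.inter (Compacts.isClosed_subsets_of_isClosed Metric.isClosed_closedBall)))
      fun K hK => hK.2.2

theorem zero_mem_interior_of_mem_convexBodies {r R : ℝ} (hr : 0 < r) (K : convexBodies d r R) :
    (0 : Euc d) ∈ interior (K.1 : Set (Euc d)) :=
  interior_maximal K.2.2.1 Metric.isOpen_ball (Metric.mem_ball_self hr)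

/-- The properly convex open set with closure the given convex body of the standard chart. -/
noncomputable def ofConvexBody {r R : ℝ} (hr : 0 < r) (K : convexBodies d r R) : ProperConvex d :=
  ⟨stdChart d '' interior (K.1 : Set (Euc d)), isProperlyConvexOpen_stdChart_image isOpen_interior
    ⟨0, zero_mem_interior_of_mem_convexBodies hr K⟩ K.2.1.interior
    (Metric.isBounded_closedBall.subset (interior_subset.trans K.2.2.2))⟩

theorem closure_ofConvexBody {r R : ℝ} (hr : 0 < r) (K : convexBodies d r R) :
    closure (ofConvexBody hr K).1 = stdChart d '' (K.1 : Set (Euc d)) := by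
  have h1 : closure (interior (K.1 : Set (Euc d))) = K.1 := by
    rw [K.2.1.closure_interior_eq_closure_of_nonempty_interior
      ⟨0, zero_mem_interior_of_mem_convexBodies hr K⟩, K.1.isCompact.isClosed.closure_eq]
  refine subset_antisymm ?_ ?_
  · exact closure_minimal (image_mono interior_subset)
      (K.1.isCompact.image continuous_stdChart).isClosed
  · nth_rewrite 1 [← h1]
    exact image_closure_subset_closure_image continuous_stdChart

/-- The topology on `ProperConvex d` is induced by the closure, which here is the image of `K` in
the chart, and taking images is continuous for the Vietoris topology. -/
theorem continuous_ofConvexBody {r R : ℝ} (hr : 0 < r) :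
    Continuous (ofConvexBody (d := d) (R := R) hr) := by
  let := TopologicalSpace.vietoris (RP d)
  let := TopologicalSpace.vietoris (Euc d)
  refine continuous_induced_rng.2 ?_
  have : ((fun Ω : ProperConvex d => closure Ω.1) ∘ ofConvexBody hr) =
      fun K : convexBodies d r R => stdChart d '' (K.1 : Set (Euc d)) :=
    funext fun K => closure_ofConvexBody hr K
  rw [this]
  exact continuous_stdChart.image_vietoris.comp
    (TopologicalSpace.Compacts.continuous_coe.comp continuous_subtype_val)

/-- A positive continuous function of pointed properly convex sets is bounded from above and from
below on normalised ones. -/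
theorem exists_bounds_of_continuousOn {r R : ℝ} (hr : 0 < r) {f : ProperConvex d → Euc d → ℝ}
    (hf : ContinuousOn (fun z : ProperConvex d × Euc d => f z.1 z.2)
      {z | affineChart (1 : PGLGroup d) z.2 ∈ z.1.1})
    (hpos : ∀ (Ω : ProperConvex d) (x : Euc d), affineChart (1 : PGLGroup d) x ∈ Ω.1 → 0 < f Ω x) :
    ∃ m M : ℝ, 0 < m ∧ 0 < M ∧ ∀ (Ω : ProperConvex d) (V : Set (Euc d)), Ω.1 = stdChart d '' V →
      Convex ℝ V → Metric.ball 0 r ⊆ V → V ⊆ Metric.closedBall 0 R →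
        m ≤ f Ω 0 ∧ f Ω 0 ≤ M := by
  have : CompactSpace (convexBodies d r R) :=
    isCompact_iff_compactSpace.1 (isCompact_convexBodies r R)
  have hmem (K : convexBodies d r R) :
      affineChart (1 : PGLGroup d) 0 ∈ (ofConvexBody hr K).1 := by
    rw [affineChart_one]
    exact mem_image_of_mem _ (zero_mem_interior_of_mem_convexBodies hr K)
  have hcont : Continuous fun K : convexBodies d r R => f (ofConvexBody hr K) 0 :=
    hf.comp_continuous ((continuous_ofConvexBody hr).prodMk continuous_const) hmem
  obtain ⟨M, hM⟩ := (isCompact_range hcont).bddAbove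
  -- The positive lower bound for `f` is obtained as an upper bound for its inverse.
  obtain ⟨M', hM'⟩ := (isCompact_range
    (hcont.inv₀ fun K => (hpos _ _ (hmem K)).ne')).bddAbove
  refine ⟨(|M'| + 1)⁻¹, |M| + 1, by positivity, by positivity, fun Ω V hΩ hc hrV hVR => ?_⟩
  have hVo : IsOpen V := by
    rw [← preimage_image_eq V stdChart_injective, ← hΩ]
    exact Ω.2.1.preimage continuous_stdChart
  -- An open convex set is the interior of its closure, so `Ω` comes from the body `closure V`.
  let K : convexBodies d r R := ⟨⟨closure V, Metric.isCompact_of_isClosed_isBounded isClosed_closure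
    (Metric.isBounded_closedBall.subset hVR).closure⟩, hc.closure, hrV.trans subset_closure,
    closure_minimal hVR Metric.isClosed_closedBall⟩
  have hK : ofConvexBody hr K = Ω := by
    refine Subtype.ext ?_
    rw [hΩ]
    change stdChart d '' interior (closure V) = _
    rw [hc.interior_closure_eq_interior_of_nonempty_interior, hVo.interior_eq]
    rw [hVo.interior_eq]
    exact ⟨0, hrV (Metric.mem_ball_self hr)⟩
  have h1 := hM (mem_range_self K)
  have h2 := hM' (mem_range_self K)
  have h3 := hpos _ _ (hmem K)
  simp only [Pi.inv_apply, hK] at h1 h2 h3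
  constructor
  · refine inv_le_of_inv_le₀ h3 ?_
    linarith [le_abs_self M']
  · linarith [le_abs_self M]

/-! ### Comparison of natural volumes -/

theorem IsProjectiveVolume.restrict_range {μ : ProperConvex d → Measure (RP d)}
    (hμ : IsProjectiveVolume μ) {Ω : ProperConvex d} {g : PGLGroup d}
    (hg : Ω.1 ⊆ range (affineChart g)) : (μ Ω).restrict (range (affineChart g)) = μ Ω := by
  refine Measure.restrict_eq_self_of_ae_mem ?_
  have h : ∀ᵐ p ∂μ Ω, p ∈ Ω.1 := hμ.carried Ω
  exact h.mono fun p hp => hg hp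

/-- Both densities at `x` are `|det (linMap A)|` times a factor bounded in terms of `d` and `μ`
only, so their ratio is bounded uniformly in `Ω` and `x`. -/
theorem IsNaturalVolume.exists_bounds_busemannVolume {μ : ProperConvex d → Measure (RP d)}
    (hμ : IsNaturalVolume μ) :
    ∃ a b : ℝ≥0, 0 < a ∧ a < b ∧ ∀ Ω : ProperConvex d,
      a • μ Ω ≤ busemannVolume Ω ∧ busemannVolume Ω ≤ b • μ Ω := by
  obtain ⟨f₁, hf₁c, hf₁p, hf₁⟩ := hμ.continuous 1
  obtain ⟨m, M, hm, hM, hmM⟩ :=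
    exists_bounds_of_continuousOn (R := outerRadius d) (innerRadius_pos d) hf₁c hf₁p
  have hR : 0 < outerRadius d ^ d := pow_pos (outerRadius_pos d) d
  have hr : 0 < innerRadius d ^ d := pow_pos (innerRadius_pos d) d
  let a : ℝ≥0 := Real.toNNReal (1 / (M * outerRadius d ^ d))
  -- The summand `a` only serves to make `a < b` strict.
  let b : ℝ≥0 := Real.toNNReal (1 / (m * innerRadius d ^ d)) + a
  have ha : 0 < a := Real.toNNReal_pos.2 (by positivity)
  refine ⟨a, b, ha, lt_add_of_pos_left _ (Real.toNNReal_pos.2 (by positivity)), fun Ω => ?_⟩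
  obtain ⟨f₀, hf₀c, hf₀p, hf₀⟩ := hμ.continuous Ω.chart
  have h₀ : μ Ω = ((volume.restrict Ω.affine).withDensity
      fun u => ENNReal.ofReal (f₀ Ω u)).map (affineChart Ω.chart) := by
    rw [← hμ.restrict_range Ω.subset_range_chart, hf₀ Ω]
    rfl
  have key : ∀ x ∈ Ω.affine,
      (a : ℝ≥0∞) * ENNReal.ofReal (f₀ Ω x) ≤ volume (Metric.ball (0 : Euc d) 1) /
          volume {v : Euc d | affineFinsler Ω.affine x v < 1} ∧
        volume (Metric.ball (0 : Euc d) 1) /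
          volume {v : Euc d | affineFinsler Ω.affine x v < 1} ≤
            (b : ℝ≥0∞) * ENNReal.ofReal (f₀ Ω x) := by
    intro x hx
    obtain ⟨A, hA⟩ := exists_normalizes Ω.isOpen_affine Ω.convex_affine Ω.isBounded_affine hx
    obtain ⟨k, Ω', hk, hΩ', hkA⟩ := hA.exists_properConvex
    have hpre : affineChart (1 : PGLGroup d) ⁻¹' Ω'.1 = fracLin A '' Ω.affine := by
      rw [affineChart_one, hΩ', preimage_image_eq _ stdChart_injective]
    have h₁ : μ Ω' = ((volume.restrict (fracLin A '' Ω.affine)).withDensity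
        fun u => ENNReal.ofReal (f₁ Ω' u)).map (stdChart d) := by
      have hrange : Ω'.1 ⊆ range (affineChart (1 : PGLGroup d)) := by
        rw [affineChart_one, hΩ']; exact image_subset_range _ _
      rw [← hμ.restrict_range hrange, hf₁ Ω', hpre, affineChart_one]
    have hc₀ : ContinuousOn (f₀ Ω) Ω.affine :=
      hf₀c.comp (f := fun u => (Ω, u)) (by fun_prop) fun u hu => hu
    have hc₁ : ContinuousOn (f₁ Ω') (fracLin A '' Ω.affine) :=
      hf₁c.comp (f := fun u => (Ω', u)) (by fun_prop) fun u hu => by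
        rw [← hpre] at hu; exact hu
    have hdens := hμ.density_eq hA hx hk hkA hc₀ hc₁ h₀ h₁
    obtain ⟨hm₁, hM₁⟩ := hmM Ω' _ hΩ' (convex_fracLin_image Ω.convex_affine hA.pos)
      hA.subset_image hA.image_subset
    obtain ⟨hl, hu⟩ := hA.busemann_density_bounds Ω.isOpen_affine Ω.convex_affine
      Ω.isBounded_affine hx
    rw [hdens, ← ENNReal.ofReal_mul (abs_nonneg _)]
    set D := |(linMap A).det|
    have hD : 0 ≤ D := abs_nonneg _
    constructor
    · refine le_trans ?_ hl
      change ENNReal.ofReal _ * _ ≤ _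
      rw [← ENNReal.ofReal_mul (by positivity)]
      refine ENNReal.ofReal_le_ofReal ?_
      calc 1 / (M * outerRadius d ^ d) * (D * f₁ Ω' 0)
          ≤ 1 / (M * outerRadius d ^ d) * (D * M) := by gcongr
        _ = D / outerRadius d ^ d := by field_simp
    · refine hu.trans ?_
      refine le_trans ?_ (mul_le_mul_left (ENNReal.coe_le_coe.2 (le_self_add :
        Real.toNNReal (1 / (m * innerRadius d ^ d)) ≤ b)) _)
      change _ ≤ ENNReal.ofReal _ * _
      rw [← ENNReal.ofReal_mul (by positivity)]
      refine ENNReal.ofReal_le_ofReal ?_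
      calc D / innerRadius d ^ d = 1 / (m * innerRadius d ^ d) * (D * m) := by field_simp
        _ ≤ 1 / (m * innerRadius d ^ d) * (D * f₁ Ω' 0) := by gcongr
  have hmeas : Measurable (affineChart Ω.chart) := (continuous_affineChart _).measurable
  have hsmul (c : ℝ≥0) : c • μ Ω = ((volume.restrict Ω.affine).withDensity
      fun u => (c : ℝ≥0∞) * ENNReal.ofReal (f₀ Ω u)).map (affineChart Ω.chart) := by
    rw [h₀, ← Measure.map_smul]
    congr 1
    exact (withDensity_smul' (c : ℝ≥0∞) _ ENNReal.coe_ne_top).symm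
  have hmem := ae_restrict_mem (μ := volume) Ω.isOpen_affine.measurableSet
  rw [hsmul, hsmul]
  exact ⟨Measure.map_mono (withDensity_mono (hmem.mono fun x hx => (key x hx).1)) hmeas,
    Measure.map_mono (withDensity_mono (hmem.mono fun x hx => (key x hx).2)) hmeas⟩

theorem IsNaturalVolume.exists_le_smul {μ μ' : ProperConvex d → Measure (RP d)}
    (hμ : IsNaturalVolume μ) (hμ' : IsNaturalVolume μ') :
    ∃ C : ℝ≥0, C ≠ 0 ∧ ∀ Ω : ProperConvex d, μ Ω ≤ C • μ' Ω := by
  obtain ⟨a, _, ha, -, hab⟩ := hμ.exists_bounds_busemannVolume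
  obtain ⟨a', b', ha', hab', h'⟩ := hμ'.exists_bounds_busemannVolume
  refine ⟨a⁻¹ * b', (mul_pos (inv_pos.2 ha) (ha'.trans hab')).ne', fun Ω => ?_⟩
  calc μ Ω = a⁻¹ • (a • μ Ω) := by rw [smul_smul, inv_mul_cancel₀ ha.ne', one_smul]
    _ ≤ a⁻¹ • (b' • μ' Ω) := by
        have h := (hab Ω).1.trans (h' Ω).2
        intro s
        simp only [Measure.smul_apply]
        exact smul_le_smul_of_nonneg_left (by simpa only [Measure.smul_apply] using h s) zero_le
    _ = (a⁻¹ * b') • μ' Ω := smul_smul _ _ _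

theorem IsQuasiDivisible.of_le_smul {μ μ' : ProperConvex d → Measure (RP d)} {Ω : ProperConvex d}
    {C : ℝ≥0} (h : μ' Ω ≤ C • μ Ω) (h' : IsQuasiDivisible μ Ω) : IsQuasiDivisible μ' Ω := by
  obtain ⟨Γ, hΓ, hdisc, D, hD, hfin⟩ := h'
  -- A fundamental domain remains one for any absolutely continuous measure.
  refine ⟨Γ, hΓ, hdisc, D, hD.mono ?_, ?_⟩
  · exact (Measure.absolutelyContinuous_of_le h).trans Measure.smul_absolutelyContinuous
  · refine (h D).trans_lt ?_
    rw [Measure.smul_apply, ENNReal.smul_def, smul_eq_mul]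
    exact ENNReal.mul_lt_top ENNReal.coe_lt_top hfin

/-! ### The triangle inequality for the Hilbert distance -/

open Classical in
/-- The ratio `|xq| / |yq|`, where `q` is the exit point of the half-line from `x` through `y`. -/
noncomputable def funkRatio (U : Set (Euc d)) (x y : Euc d) : ℝ :=
  if x = y then 1 else exitTime U x (y - x) / (exitTime U x (y - x) - 1)

/-- The inequality `x ≤ c y` in the order defined by the closed cone above `U`. -/
def ConeLE (U : Set (Euc d)) (x y : Euc d) (c : ℝ) : Prop :=
  1 ≤ c ∧ ∃ q ∈ closure U, c • y - x = (c - 1) • q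

/-- Transitivity of the cone order: `(a b) z - x` is `a (b z - y)` plus `a y - x`, a sum of two
elements of the closed cone. Rescaling to a point of `closure U` requires `a b ≠ 1`; otherwise `a =
b = 1` and both differences vanish. -/
theorem ConeLE.trans {U : Set (Euc d)} (hc : Convex ℝ U) {x y z : Euc d} {a b : ℝ}
    (h : ConeLE U x y a) (h' : ConeLE U y z b) : ConeLE U x z (a * b) := by
  obtain ⟨ha, p, hp, hxy⟩ := h
  obtain ⟨hb, q, hq, hyz⟩ := h'
  have hab : 1 ≤ a * b := one_le_mul_of_one_le_of_one_le ha hb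
  have key : (a * b) • z - x = (a * (b - 1)) • q + (a - 1) • p := by
    rw [← hxy, mul_smul, mul_smul, ← hyz, smul_sub]
    abel
  refine ⟨hab, ?_⟩
  rcases hab.eq_or_lt with h1 | h1
  · refine ⟨p, hp, ?_⟩
    have ha1 : a = 1 := le_antisymm (by nlinarith) ha
    have hb1 : b = 1 := by rw [ha1, one_mul] at h1; exact h1.symm
    rw [key, ha1, hb1]; simp
  · have hpos : 0 < a * b - 1 := sub_pos.2 h1
    refine ⟨(a * (b - 1) / (a * b - 1)) • q + ((a - 1) / (a * b - 1)) • p,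
      hc.closure hq hp (div_nonneg (mul_nonneg (by linarith) (by linarith)) hpos.le)
        (div_nonneg (by linarith) hpos.le) ?_, ?_⟩
    · rw [← add_div, div_eq_one_iff_eq hpos.ne']; ring
    · rw [key, smul_add, smul_smul, smul_smul, mul_div_cancel₀ _ hpos.ne',
        mul_div_cancel₀ _ hpos.ne']

theorem one_lt_exitTime {U : Set (Euc d)} (hU : IsOpen U) (hb : Bornology.IsBounded U)
    {x y : Euc d} (hy : y ∈ U) (hxy : x ≠ y) : 1 < exitTime U x (y - x) :=
  lt_exitTime hU hb (sub_ne_zero.2 hxy.symm) zero_le_one (by simpa using hy)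

/-- The exit point itself is the witness `q`. Together with `funkRatio_le`, this makes the Funk
ratio the least constant `c` such that `x ≤ c y`, whence its submultiplicativity. -/
theorem coneLE_funkRatio {U : Set (Euc d)} (hU : IsOpen U) (hc : Convex ℝ U)
    (hb : Bornology.IsBounded U) {x y : Euc d} (hx : x ∈ U) (hy : y ∈ U) :
    ConeLE U x y (funkRatio U x y) := by
  by_cases hxy : x = y
  · subst hxy
    rw [funkRatio, if_pos rfl]
    exact ⟨le_rfl, x, subset_closure hx, by simp⟩
  rw [funkRatio, if_neg hxy]
  have hτ := one_lt_exitTime hU hb hy hxy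
  set τ := exitTime U x (y - x) with hτ_def
  have hτ' : 0 < τ - 1 := sub_pos.2 hτ
  refine ⟨(one_le_div hτ').2 (by linarith), x + τ • (y - x), ?_, ?_⟩
  · have hcont : Continuous fun t : ℝ => x + t • (y - x) := by fun_prop
    have h1 : τ ∈ closure (Ico 0 τ) := by
      rw [closure_Ico (by linarith : (0 : ℝ) ≠ τ)]
      exact ⟨by linarith, le_rfl⟩
    refine closure_mono ?_ (image_closure_subset_closure_image hcont (mem_image_of_mem _ h1))
    rintro _ ⟨t, ht, rfl⟩
    exact mem_of_lt_exitTime hc hx ht.1 ht.2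
  · have h2 : τ / (τ - 1) - 1 = 1 / (τ - 1) := by field_simp; ring
    rw [h2]
    ext i
    simp only [PiLp.sub_apply, PiLp.smul_apply, PiLp.add_apply, smul_eq_mul]
    field_simp
    ring

theorem funkRatio_le {U : Set (Euc d)} (hU : IsOpen U) (hc : Convex ℝ U)
    (hb : Bornology.IsBounded U) {x y : Euc d} (hx : x ∈ U) (hy : y ∈ U) {c : ℝ} (h : ConeLE U x y c) :
    funkRatio U x y ≤ c := by
  obtain ⟨h1, q, hq, hxyq⟩ := h
  by_cases hxy : x = y
  · rwa [funkRatio, if_pos hxy]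
  rw [funkRatio, if_neg hxy]
  have hτ := one_lt_exitTime hU hb hy hxy
  have hv : y - x ≠ 0 := sub_ne_zero.2 (Ne.symm hxy)
  have hc1 : 1 < c := by
    refine lt_of_le_of_ne h1 fun h => hv ?_
    rw [← h, sub_self, zero_smul, one_smul] at hxyq
    exact hxyq
  rw [div_le_iff₀ (sub_pos.2 hτ)]
  by_contra hlt
  rw [not_le] at hlt
  refine add_exitTime_notMem hU hb (x := x) hv ?_
  set τ := exitTime U x (y - x)
  have hcp : 0 < c := by linarith
  have hβ : 0 ≤ τ * (c - 1) / c := div_nonneg (mul_nonneg (by linarith) (by linarith)) hcp.le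
  have hα : 0 < 1 - τ * (c - 1) / c := by
    rw [sub_pos, div_lt_one hcp]; linarith
  -- If `c` were smaller than the ratio, the exit point would be a combination of `x` and `q` with
  -- positive weight on the interior point `x`, hence would lie in `U`.
  have hmem := hc.combo_interior_closure_mem_interior (hU.interior_eq.symm ▸ hx) hq hα hβ
    (by ring)
  rw [hU.interior_eq] at hmem
  convert hmem using 1
  have h3 : (τ * (c - 1) / c) • q = (τ / c) • (c • y - x) := by
    rw [hxyq, smul_smul]; congr 1; ring
  rw [h3]
  ext i
  simp only [PiLp.sub_apply, PiLp.smul_apply, PiLp.add_apply, smul_eq_mul]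
  field_simp
  ring

theorem affineHilbertDist_eq {U : Set (Euc d)} (hU : IsOpen U) (hb : Bornology.IsBounded U)
    {x y : Euc d} (hx : x ∈ U) (hy : y ∈ U) :
    affineHilbertDist U x y = 1 / 2 * Real.log (funkRatio U x y * funkRatio U y x) := by
  by_cases hxy : x = y
  · simp [affineHilbertDist, funkRatio, hxy]
  have hdist {x y : Euc d} (hy : y ∈ U) (hxy : x ≠ y) :
      dist (exitPoint U x (y - x)) x = exitTime U x (y - x) * dist x y ∧
        dist (exitPoint U x (y - x)) y = (exitTime U x (y - x) - 1) * dist x y := by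
    have hτ := one_lt_exitTime hU hb hy hxy
    rw [exitPoint_eq]
    constructor
    · rw [dist_self_add_left, norm_smul, Real.norm_of_nonneg (by linarith), dist_comm,
        dist_eq_norm]
    · have : x + exitTime U x (y - x) • (y - x) - y = (exitTime U x (y - x) - 1) • (y - x) := by
        rw [sub_smul, one_smul]; abel
      rw [dist_eq_norm, this, norm_smul, Real.norm_of_nonneg (by linarith), dist_comm,
        dist_eq_norm]
  have hyx : y ≠ x := Ne.symm hxy
  have hτ := one_lt_exitTime hU hb hy hxy
  have hσ := one_lt_exitTime hU hb hx hyx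
  have hpos : 0 < dist x y := dist_pos.2 hxy
  rw [affineHilbertDist, if_neg hxy, funkRatio, if_neg hxy, funkRatio, if_neg hyx,
    (hdist hy hxy).1, (hdist hy hxy).2, (hdist hx hyx).1, (hdist hx hyx).2, dist_comm y x]
  congr 2
  have h1 := sub_pos.2 hτ
  have h2 := sub_pos.2 hσ
  field_simp

theorem affineHilbertDist_triangle {U : Set (Euc d)} (hU : IsOpen U) (hc : Convex ℝ U)
    (hb : Bornology.IsBounded U) {x y z : Euc d} (hx : x ∈ U) (hy : y ∈ U) (hz : z ∈ U) :
    affineHilbertDist U x z ≤ affineHilbertDist U x y + affineHilbertDist U y z := by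
  have hpos {x y : Euc d} (hx : x ∈ U) (hy : y ∈ U) : 0 < funkRatio U x y :=
    one_pos.trans_le (coneLE_funkRatio hU hc hb hx hy).1
  have htri {x y z : Euc d} (hx : x ∈ U) (hy : y ∈ U) (hz : z ∈ U) :
      funkRatio U x z ≤ funkRatio U x y * funkRatio U y z :=
    funkRatio_le hU hc hb hx hz
      ((coneLE_funkRatio hU hc hb hx hy).trans hc (coneLE_funkRatio hU hc hb hy hz))
  rw [affineHilbertDist_eq hU hb hx hz, affineHilbertDist_eq hU hb hx hy,
    affineHilbertDist_eq hU hb hy hz, ← mul_add,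
    ← Real.log_mul (mul_pos (hpos hx hy) (hpos hy hx)).ne'
      (mul_pos (hpos hy hz) (hpos hz hy)).ne']
  refine mul_le_mul_of_nonneg_left (Real.log_le_log (mul_pos (hpos hx hz) (hpos hz hx)) ?_)
    (by norm_num)
  calc funkRatio U x z * funkRatio U z x
      ≤ (funkRatio U x y * funkRatio U y z) * (funkRatio U z y * funkRatio U y x) :=
        mul_le_mul (htri hx hy hz) (htri hz hy hx) (hpos hz hx).le
          (mul_pos (hpos hx hy) (hpos hy hz)).le
    _ = _ := by ring

theorem ProperConvex.coord_mem {Ω : ProperConvex d} {p : RP d} (hp : p ∈ Ω.1) :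
    Ω.coord p ∈ Ω.affine := by
  rw [← Ω.image_affine] at hp
  obtain ⟨u, hu, rfl⟩ := hp
  rwa [ProperConvex.coord, Function.leftInverse_invFun (affineChart_injective _)]

theorem hilbertBall_subset {Ω : ProperConvex d} {x x' : RP d} (hx : x ∈ Ω.1) (hx' : x' ∈ Ω.1)
    (R : ℝ) : hilbertBall Ω x R ⊆ hilbertBall Ω x' (R + hilbertDist Ω x' x) := by
  rintro q ⟨hq, hR⟩
  refine ⟨hq, ?_⟩
  have := affineHilbertDist_triangle Ω.isOpen_affine Ω.convex_affine Ω.isBounded_affine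
    (ProperConvex.coord_mem hx') (ProperConvex.coord_mem hx) (ProperConvex.coord_mem hq)
  change hilbertDist Ω x' q ≤ hilbertDist Ω x' x + hilbertDist Ω x q at this
  linarith

/-! ### Exponential growth rates -/

/-- From `L₂ R < y R` one gets `L₁ (R - c) ≤ K + y R`, and this is at most `z (R - c)` as soon as
`(z - y) R ≥ K + z c`. The pointwise form serves both limits: `limsup` uses it eventually, `liminf`
frequently. -/
theorem eventually_div_le_of_le_add {L₁ L₂ : ℝ → EReal} {K c : ℝ}
    (h : ∀ R : ℝ, L₁ R ≤ K + L₂ (R + c)) {y z : ℝ} (hyz : y < z) :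
    ∀ᶠ R : ℝ in atTop, L₂ R / (R : EReal) < y → L₁ (R - c) / ((R - c : ℝ) : EReal) ≤ z := by
  have hlim : Tendsto (fun R : ℝ => (z - y) * R) atTop atTop :=
    tendsto_id.const_mul_atTop (sub_pos.2 hyz)
  filter_upwards [eventually_gt_atTop 0, eventually_gt_atTop c,
    hlim.eventually_ge_atTop (K + z * c)] with R hR hRc hlin hlt
  have hR' : (0 : EReal) < ((R - c : ℝ) : EReal) := EReal.coe_pos.2 (sub_pos.2 hRc)
  rw [EReal.div_le_iff_le_mul hR' (EReal.coe_ne_top _)]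
  have h1 : L₂ R ≤ (R : EReal) * (y : EReal) :=
    (EReal.div_le_iff_le_mul (EReal.coe_pos.2 hR) (EReal.coe_ne_top _)).1 hlt.le
  have h2 := h (R - c)
  rw [sub_add_cancel] at h2
  refine h2.trans ((add_le_add_right h1 _).trans ?_)
  norm_cast
  linarith

theorem limsup_div_le_of_le_add {L₁ L₂ : ℝ → EReal} {K c : ℝ}
    (h : ∀ R : ℝ, L₁ R ≤ K + L₂ (R + c)) :
    limsup (fun R : ℝ => L₁ R / (R : EReal)) atTop ≤
      limsup (fun R : ℝ => L₂ R / (R : EReal)) atTop := by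
  refine EReal.le_of_forall_lt_iff_le.1 fun z hz => ?_
  obtain ⟨y, hy, hyz⟩ := EReal.lt_iff_exists_real_btwn.1 hz
  have h1 := (eventually_div_le_of_le_add h (EReal.coe_lt_coe_iff.1 hyz)).mp
    ((eventually_lt_of_limsup_lt hy).mono fun R hR h => h hR)
  refine limsup_le_of_le (h := ?_)
  filter_upwards [(tendsto_atTop_add_const_right atTop c tendsto_id).eventually h1] with R hR
  simpa using hR

theorem liminf_div_le_of_le_add {L₁ L₂ : ℝ → EReal} {K c : ℝ}
    (h : ∀ R : ℝ, L₁ R ≤ K + L₂ (R + c)) :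
    liminf (fun R : ℝ => L₁ R / (R : EReal)) atTop ≤
      liminf (fun R : ℝ => L₂ R / (R : EReal)) atTop := by
  refine EReal.le_of_forall_lt_iff_le.1 fun z hz => ?_
  obtain ⟨y, hy, hyz⟩ := EReal.lt_iff_exists_real_btwn.1 hz
  have h1 := ((frequently_lt_of_liminf_lt (h := hy)).and_eventually
    (eventually_div_le_of_le_add h (EReal.coe_lt_coe_iff.1 hyz))).mono fun R hR => hR.2 hR.1
  refine liminf_le_of_frequently_le ?_
  exact (tendsto_atTop_add_const_right atTop (-c) tendsto_id).frequently
    (h1.mono fun R hR => by simpa [sub_eq_add_neg] using hR)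

theorem log_measure_hilbertBall_le {μ μ' : ProperConvex d → Measure (RP d)} {Ω : ProperConvex d}
    {C : ℝ≥0} (hC : C ≠ 0) (h : μ Ω ≤ C • μ' Ω) {x x' : RP d} (hx : x ∈ Ω.1) (hx' : x' ∈ Ω.1)
    (R : ℝ) : ENNReal.log (μ Ω (hilbertBall Ω x R)) ≤ (Real.log C : ℝ) +
      ENNReal.log (μ' Ω (hilbertBall Ω x' (R + hilbertDist Ω x' x))) := by
  rw [← ENNReal.log_of_nnreal hC, ← ENNReal.log_mul_add]
  refine ENNReal.log_le_log ((h _).trans ?_)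
  rw [Measure.smul_apply, ENNReal.smul_def, smul_eq_mul]
  gcongr
  exact hilbertBall_subset hx hx' R

/-! ### Independence of the natural volume and of the base point -/

theorem IsNaturalVolume.supVolumeEntropy_le {μ μ' : ProperConvex d → Measure (RP d)}
    (hμ : IsNaturalVolume μ) (hμ' : IsNaturalVolume μ') {Ω : ProperConvex d} {x x' : RP d}
    (hx : x ∈ Ω.1) (hx' : x' ∈ Ω.1) : supVolumeEntropy μ Ω x ≤ supVolumeEntropy μ' Ω x' := by
  obtain ⟨C, hC, h⟩ := hμ.exists_le_smul hμ'
  exact limsup_div_le_of_le_add (log_measure_hilbertBall_le hC (h Ω) hx hx')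

theorem IsNaturalVolume.infVolumeEntropy_le {μ μ' : ProperConvex d → Measure (RP d)}
    (hμ : IsNaturalVolume μ) (hμ' : IsNaturalVolume μ') {Ω : ProperConvex d} {x x' : RP d}
    (hx : x ∈ Ω.1) (hx' : x' ∈ Ω.1) : infVolumeEntropy μ Ω x ≤ infVolumeEntropy μ' Ω x' := by
  obtain ⟨C, hC, h⟩ := hμ.exists_le_smul hμ'
  exact liminf_div_le_of_le_add (log_measure_hilbertBall_le hC (h Ω) hx hx')

theorem IsNaturalVolume.isQuasiDivisible {μ μ' : ProperConvex d → Measure (RP d)}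
    (hμ : IsNaturalVolume μ) (hμ' : IsNaturalVolume μ') {Ω : ProperConvex d}
    (h : IsQuasiDivisible μ Ω) : IsQuasiDivisible μ' Ω := by
  obtain ⟨C, -, hC⟩ := hμ'.exists_le_smul hμ
  exact h.of_le_smul (hC Ω)

end HilbertGeometry

open HilbertGeometry
theorem mainTheorem11 (d : ℕ) :
    (∀ μ : ProperConvex d → Measure (RP d), IsNaturalVolume μ →
      ∃ a b : ℝ≥0, 0 < a ∧ a < b ∧ ∀ Ω : ProperConvex d,
        a • μ Ω ≤ busemannVolume Ω ∧ busemannVolume Ω ≤ b • μ Ω) ∧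
    (∀ μ μ' : ProperConvex d → Measure (RP d), IsNaturalVolume μ → IsNaturalVolume μ' →
      ∀ Ω : ProperConvex d,
        (IsQuasiDivisible μ Ω ↔ IsQuasiDivisible μ' Ω) ∧
        ∀ x ∈ Ω.1, ∀ x' ∈ Ω.1,
          supVolumeEntropy μ Ω x = supVolumeEntropy μ' Ω x' ∧
          infVolumeEntropy μ Ω x = infVolumeEntropy μ' Ω x') := by
  refine ⟨fun μ hμ => hμ.exists_bounds_busemannVolume, fun μ μ' hμ hμ' Ω =>
    ⟨⟨hμ.isQuasiDivisible hμ', hμ'.isQuasiDivisible hμ⟩, fun x hx x' hx' => ⟨?_, ?_⟩⟩⟩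
  · exact le_antisymm (hμ.supVolumeEntropy_le hμ' hx hx') (hμ'.supVolumeEntropy_le hμ hx' hx)
  · exact le_antisymm (hμ.infVolumeEntropy_le hμ' hx hx') (hμ'.infVolumeEntropy_le hμ hx' hx)
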